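/- A Schröder prefix of length $n$ is a lattice path of total length $n$, starting at the origin, made of up steps (length $1$, height change $+1$), down steps (length $1$, height change $-1$) and horizontal steps (length $2$, height change $0$), whose height never becomes negative. Put $\rho=\sqrt2-1$, so that $\rho+\rho+\rho^2=1$. For a target length $n$, the anticipated rejection sampler builds a path from independent random steps, each of them up, down or horizontal with respective probabilities $\rho,\rho,\rho^2$. As soon as the path goes below height $0$, or its length jumps from $n-1$ to $n+1$, the path is discarded and the construction restarts from the empty path; the sampler stops as soon as the path under construction has length exactly $n$. Let $Y_n$ be the total length of all the steps drawn, in the failed attempts (including the step that causes the rejection) and in the successful one. For $0<\alpha<1$ let $$\phi_\alpha(s)=\Bigl(1-\sum_{m\ge1}\frac{\alpha}{m-\alpha}\,\frac{(is)^m}{m!}\Bigr)^{-1}$$ be the characteristic function of the Darling–Mandelbrot law of parameter $\alpha$, let $\mathcal D(\alpha)$ be the shifted law, with characteristic function $e^{is}\phi_\alpha(s)$, and for $0<p\le1$ let $\mathcal D(\alpha,p)$ be its geometric convolution, that is, the law of $W_1+\dots+W_Z$ with $W_1,W_2,\dots$ independent of law $\mathcal D(\alpha)$ and $Z$ independent of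 them with $\mathbb P(Z=k)=(1-p)^{k-1}p$ for $k\ge1$. **Proposition.** For every $n\ge0$ the sampler stops almost surely and $Y_n$ is integrable. The probability law $\mathcal D\bigl(\tfrac12,\tfrac{2+\sqrt2}4\bigr)$ exists and, as $n\to\infty$, $Y_n/n$ converges in distribution to it. Moreover $\mathbb E(Y_n)\sim(8-4\sqrt2)\,n$. -/

import Mathlib

open MeasureTheory ProbabilityTheory Filter Asymptotics

/-- The three steps of a Schröder path. -/
inductive SchroderStep where
  | up
  | down
  | flat

namespace SchroderStep

instance : MeasurableSpace SchroderStep := ⊤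

/-- Length of a step: the horizontal step has length `2`, the two others have length `1`. -/
def length : SchroderStep → ℕ
  | up => 1
  | down => 1
  | flat => 2

/-- Height increment of a step. -/
def rise : SchroderStep → ℤ
  | up => 1
  | down => -1
  | flat => 0

/-- The constant `ρ = √2 - 1`. -/
noncomputable def rho : ℝ := √2 - 1

/-- Probability with which the sampler draws a step: `ρ`, `ρ`, `ρ²`. -/
noncomputable def weight : SchroderStep → ℝ
  | up => rho
  | down => rho
  | flat => rho ^ 2

end SchroderStep

namespace SchroderSampler

/-- One step of the sampler with target length `n`. The state is the pair (length, final height)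
of the path under construction. The drawn step is appended to the path; if the new path goes below
the origin or is longer than `n` (a jump from `n - 1` to `n + 1`), it is discarded and the
construction restarts from the empty path. -/
def advance (n : ℕ) (st : ℕ × ℤ) (s : SchroderStep) : ℕ × ℤ :=
  if st.2 + s.rise < 0 ∨ n < st.1 + s.length then (0, 0)
  else (st.1 + s.length, st.2 + s.rise)

/-- State after `k` draws, when the successive drawn steps are `x 0, x 1, …`. -/
def state (n : ℕ) (x : ℕ → SchroderStep) : ℕ → ℕ × ℤ
  | 0 => (0, 0)
  | k + 1 => advance n (state n x k) (x k)

/-- The sampler stops: at some time the path under construction has length exactly `n`. -/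
def Halts (n : ℕ) (x : ℕ → SchroderStep) : Prop :=
  ∃ k, (state n x k).1 = n

/-- Number of steps drawn until the path under construction first has length `n`
(relevant only when the sampler stops). -/
noncomputable def haltTime (n : ℕ) (x : ℕ → SchroderStep) : ℕ :=
  sInf {k | (state n x k).1 = n}

/-- Total length of all the steps drawn, in the failed attempts and in the successful one. -/
noncomputable def drawnLength (n : ℕ) (x : ℕ → SchroderStep) : ℕ :=
  ∑ k ∈ Finset.range (haltTime n x), (x k).length

end SchroderSampler

/-- The characteristic function
`φ_α(s) = (1 - ∑_{n ≥ 1} α / (n - α) * (i s)ⁿ / n!)⁻¹`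
of the Darling–Mandelbrot law of parameter `α`, for `0 < α < 1`. -/
noncomputable def darlingMandelbrotCharFun (α s : ℝ) : ℂ :=
  (1 - ∑' m : ℕ, (α : ℂ) / ((m + 1 : ℂ) - α) *
    (Complex.I * s) ^ (m + 1) / ((m + 1).factorial : ℂ))⁻¹

/-- `ν` is the law `𝒟(α)`: the Darling–Mandelbrot law shifted by one, i.e. the probability measure
with characteristic function `e^{is} φ_α(s)`. -/
structure IsShiftedDarlingMandelbrot (α : ℝ) (ν : Measure ℝ) : Prop where
  isProbabilityMeasure : IsProbabilityMeasure ν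
  charFun_eq : ∀ s : ℝ, charFun ν s = Complex.exp (Complex.I * s) * darlingMandelbrotCharFun α s

/-- The `k`-fold convolution power of a measure: the law of the sum of `k` independent variables
of law `ν`. -/
noncomputable def convPower (ν : Measure ℝ) : ℕ → Measure ℝ
  | 0 => Measure.dirac 0
  | k + 1 => Measure.conv (convPower ν k) ν

/-- The geometric convolution of `ν`: the law of `W₁ + ⋯ + W_Z`, where the `Wᵢ` are independent of
law `ν` and `Z ≥ 1` is independent of them and geometric, `P(Z = k + 1) = (1 - p)ᵏ p`. -/
noncomputable def geometricConvolution (p : ℝ) (ν : Measure ℝ) : Measure ℝ :=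
  Measure.sum fun k : ℕ => ENNReal.ofReal ((1 - p) ^ k * p) • convPower ν (k + 1)

/-- `L` is the law `𝒟(α, p)`: the geometric convolution with parameter `p` of `𝒟(α)`. -/
def IsGeometricDarlingMandelbrot (α p : ℝ) (L : Measure ℝ) : Prop :=
  ∃ ν : Measure ℝ, IsShiftedDarlingMandelbrot α ν ∧ L = geometricConvolution p ν

/-! The first passage below `0` has an algebraic generating function. With `y = ρ z`, first-step
analysis gives `h = y (1 + h²) + y² h`, and a start at height `k - 1` gives `h ^ k`. The survival
series is `(1 - h ^ k) / (1 - 2 y - y²)`, whose denominator factors as `(1 - z) (1 + ρ² z)`. The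
root `h` involves `√((1 + z) (1 - ρ² z) / ((1 - z) (1 + ρ² z)))`, so by Stirling the probability
`u_n` that an attempt succeeds is asymptotic to `c / √n` (`survival_eq_ratioSeries`,
`exists_tendsto_sqrt_mul_survival`).

The law of `Y_n` comes from a martingale rather than from a decomposition into attempts. The
expected final payoff, as a function of the current state, is harmonic for the stopped chain
(`stateValue_eq_stopStep`). Letting time tend to infinity (`integral_comp_drawnLength`) gives the
mean of `Y_n` and its generating function `u_n z ^ n / (1 - F_n z)`, where `F_n` is the generating
polynomial of the length of a failed attempt.

At `z = exp (i t / n)`, expand `1 - F_n` in powers of `i t`. The truncated moments of the passage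
length, scaled by `√n`, converge to multiples of `(1/2) / (m - 1/2)` (`tendsto_passageMoment`),
which are the Darling–Mandelbrot coefficients. The limit is `e^{it} / ((1 + ρ²) (1 - D) - ρ²
e^{it})`, with `D` the Darling–Mandelbrot series. This is the geometric compound of `e^{it} / (1 -
D)` with `p = 1 / (1 + ρ²)`. The Darling–Mandelbrot law itself is obtained as a weak limit of
explicit geometric compounds, and Lévy continuity concludes. -/

open PowerSeries in
/-- A formal solution of `f² (1 - X) = 1 + X`, in terms of its logarithmic derivative. -/
theorem PowerSeries.sq_mul_one_sub_X_of_derivative {A : PowerSeries ℝ}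
    (h0 : constantCoeff A = 1) (h : derivative ℝ A * (1 - X ^ 2) = A) :
    A ^ 2 * (1 - X) = 1 + X := by
  set B : PowerSeries ℝ := A ^ 2 * (1 - X) - (1 + X) with hB
  have hB0 : coeff 0 B = 0 := by simp [hB, h0]
  have hd : derivative ℝ B * (1 + X) = B := by
    have : derivative ℝ B = 2 * A * derivative ℝ A * (1 - X) - A ^ 2 - 1 := by
      simp only [hB, map_sub, map_add, Derivation.leibniz, derivative_X, pow_two, smul_eq_mul,
        Derivation.map_one_eq_zero]
      ring
    rw [this]
    linear_combination 2 * A * h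
  -- The linear equation `B' (1 + X) = B` gives `(n + 1) b_{n+1} = (1 - n) b_n`, so `b_0 = 0` forces
  -- `B = 0`.
  have key : ∀ n, coeff n B = 0 := by
    intro n
    induction n with
    | zero => exact hB0
    | succ n ih =>
      have := congrArg (coeff n) hd
      rw [mul_add, mul_one, map_add, coeff_derivative, ih] at this
      rcases n with _ | n
      · simpa using this
      · rw [coeff_succ_mul_X, coeff_derivative, ih, zero_mul, add_zero] at this
        have h2 : ((n + 1 : ℕ) : ℝ) + 1 ≠ 0 := by positivity
        exact (mul_eq_zero.1 this).resolve_right h2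
  exact sub_eq_zero.1 (PowerSeries.ext fun n => by rw [← hB, key n, map_zero])

/-! ### Generating functions of first passage and survival -/

namespace SchroderSampler

open PowerSeries SchroderStep

theorem rho_pos : 0 < rho := by
  have : (1 : ℝ) < √2 := by
    rw [Real.lt_sqrt] <;> norm_num
  unfold rho; linarith

theorem rho_sq : rho ^ 2 = 1 - 2 * rho := by
  have : (√2) ^ 2 = 2 := Real.sq_sqrt (by norm_num)
  unfold rho; linear_combination this

theorem rho_lt_half : rho < 1 / 2 := by
  have := rho_sq
  have := sq_pos_of_pos rho_pos
  linarith

/-- The coefficients of `√((1 + z) / (1 - z))`. -/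
noncomputable def centralCoeff (n : ℕ) : ℝ := ((n / 2).centralBinom : ℝ) / 4 ^ (n / 2)

theorem centralCoeff_even (k : ℕ) : centralCoeff (2 * k) = (k.centralBinom : ℝ) / 4 ^ k := by
  simp [centralCoeff]

theorem centralCoeff_odd (k : ℕ) : centralCoeff (2 * k + 1) = (k.centralBinom : ℝ) / 4 ^ k := by
  simp [centralCoeff, show (2 * k + 1) / 2 = k by omega]

theorem centralBinom_div_succ (k : ℕ) :
    (2 * (k : ℝ) + 2) * (((k + 1).centralBinom : ℝ) / 4 ^ (k + 1)) =
      (2 * k + 1) * ((k.centralBinom : ℝ) / 4 ^ k) := by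
  have h : ((k : ℝ) + 1) * ((k + 1).centralBinom : ℝ) = 2 * (2 * k + 1) * k.centralBinom := by
    exact_mod_cast Nat.succ_mul_centralBinom_succ k
  field_simp
  rw [pow_succ]
  linear_combination 2 * 4 ^ k * h

/-- Coefficient form of `f' (1 - z²) = f`, the equation for the logarithmic derivative of `√((1 + z)
/ (1 - z))`. -/
theorem centralCoeff_rec (n : ℕ) :
    ((n : ℝ) + 2) * centralCoeff (n + 2) = centralCoeff (n + 1) + n * centralCoeff n := by
  obtain ⟨k, rfl | rfl⟩ := Nat.even_or_odd' n
  · rw [show 2 * k + 2 = 2 * (k + 1) by ring, centralCoeff_even, centralCoeff_odd,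
      centralCoeff_even]
    push_cast
    linear_combination centralBinom_div_succ k
  · rw [show 2 * k + 1 + 2 = 2 * (k + 1) + 1 by ring, show 2 * k + 1 + 1 = 2 * (k + 1) by ring,
      centralCoeff_even, centralCoeff_odd, centralCoeff_odd]
    push_cast
    linear_combination centralBinom_div_succ k

/-- The power series of `√((1 + z) / (1 - z))`. -/
noncomputable def centralSeries : PowerSeries ℝ := PowerSeries.mk centralCoeff

theorem constantCoeff_centralSeries : constantCoeff centralSeries = 1 := by
  rw [← coeff_zero_eq_constantCoeff_apply, centralSeries, coeff_mk]
  simp [centralCoeff]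

theorem centralSeries_sq : centralSeries ^ 2 * (1 - X) = 1 + X := by
  refine sq_mul_one_sub_X_of_derivative constantCoeff_centralSeries ?_
  ext n
  rw [mul_sub, mul_one, map_sub, coeff_mul_X_pow', coeff_derivative]
  rcases n with _ | _ | n
  · simp [centralSeries, centralCoeff]
  · have := centralCoeff_rec 0
    simp only [centralSeries, coeff_mk] at this ⊢
    norm_num at this ⊢
    linarith
  · have := centralCoeff_rec (n + 1)
    simp only [centralSeries, coeff_mk, coeff_derivative] at this ⊢
    rw [if_pos (by omega), show n + 1 + 1 - 2 = n by omega]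
    push_cast at this ⊢
    linarith

/-- The power series of `√((1 + z) (1 - ρ² z) / ((1 - z) (1 + ρ² z)))`. -/
noncomputable def ratioSeries : PowerSeries ℝ :=
  centralSeries * rescale (-rho ^ 2) centralSeries

theorem constantCoeff_ratioSeries : constantCoeff ratioSeries = 1 := by
  rw [ratioSeries, map_mul, constantCoeff_centralSeries, ← coeff_zero_eq_constantCoeff_apply,
    coeff_rescale, coeff_zero_eq_constantCoeff_apply, constantCoeff_centralSeries]
  simp

theorem coeff_ratioSeries (n : ℕ) : coeff n ratioSeries =
    ∑ p ∈ Finset.HasAntidiagonal.antidiagonal n, centralCoeff p.1 * ((-rho ^ 2) ^ p.2 * centralCoeff p.2) := by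
  simp [ratioSeries, coeff_mul, coeff_rescale, centralSeries]

theorem ratioSeries_sq : ratioSeries ^ 2 * ((1 - X) * (1 + C (rho ^ 2) * X)) =
    (1 + X) * (1 - C (rho ^ 2) * X) := by
  have h := congrArg (rescale (-rho ^ 2)) centralSeries_sq
  simp only [map_mul, map_pow, map_sub, map_add, map_one, rescale_X, map_neg] at h
  have h1 := centralSeries_sq
  simp only [ratioSeries, map_pow] at *
  linear_combination (rescale (-rho ^ 2) centralSeries) ^ 2 * (1 + C rho ^ 2 * X) * h1 +
    (1 + X) * h

/-- `1 - 2 ρ X - ρ² X²`. -/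
noncomputable def stepDenom : PowerSeries ℝ := (1 - X) * (1 + C (rho ^ 2) * X)

theorem C_two : (C 2 : PowerSeries ℝ) = 2 := map_ofNat C 2

theorem C_rho_sq : (C rho : PowerSeries ℝ) ^ 2 = 1 - 2 * C rho := by
  rw [← map_pow, rho_sq, map_sub, map_one, map_mul, C_two]

theorem stepDenom_eq : stepDenom = 1 - 2 * (C rho * X) - (C rho * X) ^ 2 := by
  simp only [stepDenom, map_pow]
  linear_combination (X : PowerSeries ℝ) * C_rho_sq

theorem constantCoeff_stepDenom : constantCoeff stepDenom = 1 := by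
  simp [stepDenom]

/-- The generating function of the paths from `0` whose last step is the first to go below `0`. -/
noncomputable def hitSeries : PowerSeries ℝ :=
  PowerSeries.mk fun n => coeff (n + 1) (1 - (C rho * X) ^ 2 - ratioSeries * stepDenom) / (2 * rho)

/-- The quadratic formula with its denominator cleared. The right side has no constant term, so
nothing is lost in the shift by one that defines `hitSeries`. -/
theorem two_mul_X_mul_hitSeries :
    2 * (C rho * X) * hitSeries = 1 - (C rho * X) ^ 2 - ratioSeries * stepDenom := by
  ext n
  rw [show 2 * (C rho * X) * hitSeries = C (2 * rho) * (hitSeries * X) by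
    rw [map_mul, C_two]; ring, coeff_C_mul]
  rcases n with _ | n
  · simp [constantCoeff_stepDenom, constantCoeff_ratioSeries]
  · rw [coeff_succ_mul_X, hitSeries, coeff_mk]
    have := rho_pos.ne'
    field_simp

theorem C_rho_mul_X_ne_zero : (C rho * X : PowerSeries ℝ) ≠ 0 := by
  intro h
  have := congrArg (coeff 1) h
  rw [show (1 : ℕ) = 0 + 1 from rfl, coeff_succ_mul_X] at this
  simp at this
  exact rho_pos.ne' this

/-- First-step analysis: a down step ends the excursion, an up step leaves two levels to descend, a
flat step changes nothing. With `y = ρ X`, the discriminant `(1 - y²)² - 4 y²` is the square of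
`ratioSeries * stepDenom`; squaring the quadratic formula gives the equation times `4 y`, which
cancels in a domain. -/
theorem hitSeries_eq : hitSeries =
    C rho * X * (1 + hitSeries ^ 2) + (C rho * X) ^ 2 * hitSeries := by
  have h1 := two_mul_X_mul_hitSeries
  have h2 := ratioSeries_sq
  have h3 := stepDenom_eq
  rw [← stepDenom] at h2
  have h4 : (1 + X) * (1 - C (rho ^ 2) * X) = 1 + 2 * (C rho * X) - (C rho * X) ^ 2 := by
    simp only [map_pow]
    linear_combination -(X : PowerSeries ℝ) * C_rho_sq
  rw [h4] at h2
  set y : PowerSeries ℝ := C rho * X with hy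
  have : (4 * y) * hitSeries = (4 * y) *
      (y * (1 + hitSeries ^ 2) + y ^ 2 * hitSeries) := by
    have h5 : (ratioSeries * stepDenom) ^ 2 = (1 + 2 * y - y ^ 2) * (1 - 2 * y - y ^ 2) := by
      rw [← h3, ← h2]; ring
    have h6 : ratioSeries * stepDenom = 1 - y ^ 2 - 2 * y * hitSeries := by
      rw [h1]; ring
    rw [h6] at h5
    linear_combination -h5
  refine mul_left_cancel₀ ?_ this
  refine mul_ne_zero (fun h => ?_) C_rho_mul_X_ne_zero
  have h4 := congrArg constantCoeff h
  rw [map_ofNat, map_zero] at h4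
  norm_num at h4

theorem coeff_hitSeries_succ_succ (n : ℕ) : coeff (n + 2) hitSeries =
    rho * coeff (n + 1) (hitSeries ^ 2) + rho ^ 2 * coeff n hitSeries := by
  conv_lhs => rw [hitSeries_eq]
  rw [mul_pow, ← map_pow, mul_assoc, mul_comm X, mul_assoc, mul_comm (X ^ 2), map_add, coeff_C_mul,
    coeff_C_mul, coeff_mul_X_pow, show n + 2 = n + 1 + 1 from rfl, coeff_succ_mul_X, map_add]
  simp [coeff_one]

theorem coeff_hitSeries_zero : coeff 0 hitSeries = 0 := by
  rw [hitSeries_eq]; simp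

theorem coeff_hitSeries_one : coeff 1 hitSeries = rho := by
  conv_lhs => rw [hitSeries_eq]
  rw [mul_pow, ← map_pow, mul_assoc, mul_comm X, mul_assoc, mul_comm (X ^ 2), map_add, coeff_C_mul,
    coeff_C_mul, coeff_mul_X_pow', show 1 = 0 + 1 from rfl, coeff_succ_mul_X, map_add]
  have := coeff_hitSeries_zero
  simp at this ⊢
  simp [this]

theorem coeff_mul_nonneg {A B : PowerSeries ℝ} {n : ℕ} (hA : ∀ i ≤ n, 0 ≤ coeff i A)
    (hB : ∀ i ≤ n, 0 ≤ coeff i B) : 0 ≤ coeff n (A * B) := by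
  rw [coeff_mul]
  refine Finset.sum_nonneg fun p hp => ?_
  rw [Finset.HasAntidiagonal.mem_antidiagonal] at hp
  exact mul_nonneg (hA _ (by omega)) (hB _ (by omega))

/-- The closed form is a difference and hides the sign; the recursion has nonnegative coefficients.
-/
theorem coeff_hitSeries_nonneg (n : ℕ) : 0 ≤ coeff n hitSeries := by
  induction n using Nat.strong_induction_on with
  | _ n ih =>
    rcases n with _ | _ | n
    · exact coeff_hitSeries_zero.ge
    · exact coeff_hitSeries_one.ge.trans' rho_pos.le
    · rw [coeff_hitSeries_succ_succ]
      have h1 : 0 ≤ coeff (n + 1) (hitSeries ^ 2) := by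
        rw [pow_two]
        exact coeff_mul_nonneg (fun i hi => ih i (by omega)) (fun i hi => ih i (by omega))
      have := ih n (by omega)
      have := rho_pos
      positivity

/-- The probability that a path started at height `k - 1` first goes below `0` when its length
is `m`. -/
noncomputable def passage (m k : ℕ) : ℝ := coeff m (hitSeries ^ k)

/-- The probability that a path started at height `k - 1` reaches length `j` without going
below `0`. -/
noncomputable def survival (j k : ℕ) : ℝ := coeff j ((1 - hitSeries ^ k) * stepDenom⁻¹)

theorem passage_nonneg (m k : ℕ) : 0 ≤ passage m k := by
  unfold passage
  induction k generalizing m with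
  | zero => rw [pow_zero, coeff_one]; split_ifs <;> norm_num
  | succ k ih =>
    rw [pow_succ]
    exact coeff_mul_nonneg (fun i _ => ih i) (fun i _ => coeff_hitSeries_nonneg i)

theorem passage_zero_right (m : ℕ) : passage m 0 = if m = 0 then 1 else 0 := by
  simp [passage, coeff_one]

theorem passage_zero_succ (k : ℕ) : passage 0 (k + 1) = 0 := by
  have := coeff_hitSeries_zero
  simp at this
  simp [passage, this]

theorem survival_zero_right (j : ℕ) : survival j 0 = 0 := by
  simp [survival]

theorem survival_zero_succ (k : ℕ) : survival 0 (k + 1) = 1 := by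
  have := coeff_hitSeries_zero
  simp at this
  simp [survival, this, constantCoeff_stepDenom]

theorem hitSeries_pow_succ (k : ℕ) : hitSeries ^ (k + 1) =
    C rho * ((hitSeries ^ (k + 2) + hitSeries ^ k) * X) +
      C (rho ^ 2) * (hitSeries ^ (k + 1) * X ^ 2) := by
  have := hitSeries_eq
  rw [map_pow]
  linear_combination hitSeries ^ k * this

theorem stepDenom_mul_inv : stepDenom * stepDenom⁻¹ = 1 :=
  PowerSeries.mul_inv_cancel _ (by rw [constantCoeff_stepDenom]; exact one_ne_zero)

/-- Unconstrained paths have generating function `stepDenom⁻¹`, and those that have already gone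
below `0` contribute `hitSeries ^ k * stepDenom⁻¹`. The difference obeys the first-step recursion,
with a `1` for the empty path. -/
theorem survivalSeries_succ (k : ℕ) : (1 - hitSeries ^ (k + 1)) * stepDenom⁻¹ =
    1 + (C rho * (((1 - hitSeries ^ (k + 2)) * stepDenom⁻¹ + (1 - hitSeries ^ k) * stepDenom⁻¹) * X)
      + C (rho ^ 2) * ((1 - hitSeries ^ (k + 1)) * stepDenom⁻¹ * X ^ 2)) := by
  have h1 := hitSeries_eq
  have h2 := stepDenom_mul_inv
  have h3 := stepDenom_eq
  rw [map_pow]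
  set G := stepDenom⁻¹
  rw [h3] at h2
  linear_combination -hitSeries ^ k * G * h1 + h2

theorem coeff_C_mul_X_add (a b : ℝ) (A B : PowerSeries ℝ) (n : ℕ) :
    coeff (n + 2) (C a * (A * X) + C b * (B * X ^ 2)) = a * coeff (n + 1) A + b * coeff n B := by
  rw [map_add, coeff_C_mul, coeff_C_mul, coeff_mul_X_pow, show n + 2 = n + 1 + 1 from rfl,
    coeff_succ_mul_X]

theorem coeff_one_C_mul_X_add (a b : ℝ) (A B : PowerSeries ℝ) :
    coeff 1 (C a * (A * X) + C b * (B * X ^ 2)) = a * coeff 0 A := by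
  rw [map_add, coeff_C_mul, coeff_C_mul, coeff_mul_X_pow', show 1 = 0 + 1 from rfl,
    coeff_succ_mul_X]
  simp

theorem passage_succ_succ (m k : ℕ) : passage (m + 2) (k + 1) =
    rho * (passage (m + 1) (k + 2) + passage (m + 1) k) + rho ^ 2 * passage m (k + 1) := by
  simp only [passage]
  conv_lhs => rw [hitSeries_pow_succ]
  rw [coeff_C_mul_X_add, map_add]

theorem passage_one_succ (k : ℕ) : passage 1 (k + 1) =
    rho * (passage 0 (k + 2) + passage 0 k) := by
  simp only [passage]
  conv_lhs => rw [hitSeries_pow_succ]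
  rw [coeff_one_C_mul_X_add, map_add]

theorem survival_succ_succ (j k : ℕ) : survival (j + 2) (k + 1) =
    rho * (survival (j + 1) (k + 2) + survival (j + 1) k) + rho ^ 2 * survival j (k + 1) := by
  simp only [survival]
  conv_lhs => rw [survivalSeries_succ]
  rw [map_add, coeff_C_mul_X_add, map_add, coeff_one]
  simp

theorem survival_one_succ (k : ℕ) : survival 1 (k + 1) =
    rho * (survival 0 (k + 2) + survival 0 k) := by
  simp only [survival]
  conv_lhs => rw [survivalSeries_succ]
  rw [map_add, coeff_one_C_mul_X_add, map_add, coeff_one]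
  simp

theorem survival_nonneg (j k : ℕ) : 0 ≤ survival j k := by
  induction j using Nat.strong_induction_on generalizing k with
  | _ j ih =>
    have hr := rho_pos
    rcases k with _ | k
    · rw [survival_zero_right]
    rcases j with _ | _ | j
    · rw [survival_zero_succ]; exact zero_le_one
    · rw [survival_one_succ]
      have := ih 0 (by omega) (k + 2)
      have := ih 0 (by omega) k
      positivity
    · rw [survival_succ_succ]
      have := ih (j + 1) (by omega) (k + 2)
      have := ih (j + 1) (by omega) k
      have := ih j (by omega) (k + 1)
      positivity

theorem survival_pos (j k : ℕ) : 0 < survival j (k + 1) := by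
  have hr := rho_pos
  induction j generalizing k with
  | zero => rw [survival_zero_succ]; exact zero_lt_one
  | succ j ih =>
    have h1 := ih (k + 1)
    have h2 := survival_nonneg j k
    rcases j with _ | j
    · rw [survival_one_succ]; positivity
    · rw [survival_succ_succ]
      have := survival_nonneg j (k + 1)
      positivity

/-- The probability that a path reaches length `j - 1` without going below `0`, started at height
`k - 1`. -/
noncomputable def preSurvival : ℕ → ℕ → ℝ
  | 0, _ => 0
  | j + 1, k => survival j k

theorem preSurvival_nonneg (j k : ℕ) : 0 ≤ preSurvival j k := by
  cases j
  · exact le_rfl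
  · exact survival_nonneg _ _

/-- A path either goes below `0` before it exceeds length `j`, or jumps over length `j`, or
reaches it. -/
theorem sum_passage_add (j k : ℕ) : ∑ m ∈ Finset.range (j + 1), passage m k +
    rho ^ 2 * preSurvival j k + survival j k = 1 := by
  -- The factor `1 + ρ² X` of `stepDenom` adds the overshoots to the survivors; the factor `1 - X`
  -- takes differences, so the identity telescopes.
  have key : (1 - hitSeries ^ k) * stepDenom⁻¹ * (1 + C (rho ^ 2) * X) * (1 - X) =
      1 - hitSeries ^ k := by
    have := stepDenom_mul_inv
    rw [show stepDenom = (1 - X) * (1 + C (rho ^ 2) * X) from rfl] at this ⊢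
    linear_combination (1 - hitSeries ^ k) * this
  have h2 : ∀ n, coeff n ((1 - hitSeries ^ k) * stepDenom⁻¹ * (1 + C (rho ^ 2) * X)) =
      rho ^ 2 * preSurvival n k + survival n k := by
    intro n
    rw [mul_add, mul_one, map_add, mul_left_comm, coeff_C_mul, add_comm]
    rcases n with _ | n
    · simp [preSurvival, survival]
    · rw [coeff_succ_mul_X]; rfl
  have h3 : ∀ n, coeff n (1 - hitSeries ^ k) = (if n = 0 then 1 else 0) - passage n k := by
    intro n; rw [map_sub, coeff_one]; rfl
  suffices h : ∀ j, rho ^ 2 * preSurvival j k + survival j k =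
      1 - ∑ m ∈ Finset.range (j + 1), passage m k by
    have := h j; linarith
  intro j
  induction j with
  | zero =>
    have := h3 0
    rw [← key, mul_sub, mul_one, map_sub, h2] at this
    simpa using this
  | succ j ih =>
    have := h3 (j + 1)
    rw [← key, mul_sub, mul_one, map_sub, h2, coeff_succ_mul_X, h2, ih] at this
    rw [Finset.sum_range_succ]
    simp at this
    linarith

/-- Subtracting `stepDenom_eq` from the quadratic formula leaves `ratioSeries - 1 = 2 ρ X` times the
survival series: the asymptotics of survival reduce to those of an explicit product of square roots.
-/
theorem survival_eq_ratioSeries (n : ℕ) :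
    2 * rho * survival n 1 = coeff (n + 1) ratioSeries := by
  have h1 := two_mul_X_mul_hitSeries
  have h2 : (ratioSeries - 1) * stepDenom =
      2 * (C rho * X) * (1 - hitSeries ^ 1) := by
    have := stepDenom_eq
    rw [pow_one]
    linear_combination h1 - this
  have h3 : ratioSeries = 1 + C (2 * rho) * ((1 - hitSeries ^ 1) * stepDenom⁻¹ * X) := by
    have := stepDenom_mul_inv
    rw [map_mul, C_two]
    linear_combination stepDenom⁻¹ * h2 - (ratioSeries - 1) * this
  rw [h3, map_add, coeff_C_mul, coeff_succ_mul_X, coeff_one]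
  simp [survival]

end SchroderSampler

/-! ### The stopped sampler and its value functions -/

namespace SchroderSampler

open SchroderStep

section Payoff

variable {E : Type*} [AddCommGroup E] [Module ℝ E]

/-- Expected payoff of an attempt of which the length is `j` below the target and the height is
`k - 1`, when `a` has been drawn so far: `φ` is paid upon failure, `ψ` upon success. -/
noncomputable def payoff (φ ψ : ℕ → E) (a j k : ℕ) : E :=
  ∑ m ∈ Finset.range (j + 1), passage m k • φ (a + m) +
    (rho ^ 2 * preSurvival j k) • φ (a + j + 1) + survival j k • ψ (a + j)

variable (φ ψ : ℕ → E)

theorem preSurvival_zero_right (j : ℕ) : preSurvival j 0 = 0 := by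
  cases j
  · rfl
  · exact survival_zero_right _

/-- The index `k = 0` encodes height `-1`, an attempt that has just failed. -/
theorem payoff_zero_right (a j : ℕ) : payoff φ ψ a j 0 = φ a := by
  simp [payoff, preSurvival_zero_right, survival_zero_right, passage_zero_right]

theorem payoff_zero_succ (a k : ℕ) : payoff φ ψ a 0 (k + 1) = ψ a := by
  simp [payoff, preSurvival, survival_zero_succ, passage_zero_succ]

/-- At distance one from the target the flat step overshoots, hence the immediate `φ (a + 2)` in
place of a payoff. -/
theorem payoff_one_succ (a k : ℕ) : payoff φ ψ a 1 (k + 1) =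
    rho • payoff φ ψ (a + 1) 0 (k + 2) + rho • payoff φ ψ (a + 1) 0 k +
      rho ^ 2 • φ (a + 2) := by
  simp only [payoff, Finset.sum_range_succ, Finset.sum_range_zero, preSurvival, survival_one_succ,
    passage_one_succ, survival_zero_succ, passage_zero_succ, Nat.add_zero]
  module

theorem payoff_succ_succ (a j k : ℕ) : payoff φ ψ a (j + 2) (k + 1) =
    rho • payoff φ ψ (a + 1) (j + 1) (k + 2) + rho • payoff φ ψ (a + 1) (j + 1) k +
      rho ^ 2 • payoff φ ψ (a + 2) j (k + 1) := by
  have hsum : ∑ m ∈ Finset.range (j + 2 + 1), passage m (k + 1) • φ (a + m) =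
      rho • ∑ m ∈ Finset.range (j + 1 + 1), passage m (k + 2) • φ (a + 1 + m) +
      rho • ∑ m ∈ Finset.range (j + 1 + 1), passage m k • φ (a + 1 + m) +
      rho ^ 2 • ∑ m ∈ Finset.range (j + 1), passage m (k + 1) • φ (a + 2 + m) := by
    rw [Finset.sum_range_succ', Finset.sum_range_succ', Finset.sum_range_succ' _ (j + 1),
      Finset.sum_range_succ' _ (j + 1)]
    have e : ∀ m, passage (m + 1 + 1) (k + 1) • φ (a + (m + 1 + 1)) =
        rho • passage (m + 1) (k + 2) • φ (a + 1 + (m + 1)) +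
          rho • passage (m + 1) k • φ (a + 1 + (m + 1)) +
          rho ^ 2 • passage m (k + 1) • φ (a + 2 + m) := by
      intro m
      rw [passage_succ_succ, show a + (m + 1 + 1) = a + 2 + m by omega,
        show a + 1 + (m + 1) = a + 2 + m by omega]
      module
    simp_rw [e, Finset.sum_add_distrib, ← Finset.smul_sum]
    rw [passage_zero_succ, Nat.zero_add, passage_one_succ, Nat.add_zero]
    module
  -- The default value `0` of `preSurvival` at `0` makes the recursion valid for `j = 0` too.
  have h1 : rho ^ 2 * preSurvival (j + 2) (k + 1) = rho * (rho ^ 2 * preSurvival (j + 1) (k + 2)) +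
      rho * (rho ^ 2 * preSurvival (j + 1) k) + rho ^ 2 * (rho ^ 2 * preSurvival j (k + 1)) := by
    rcases j with _ | j
    · simp only [preSurvival, survival_one_succ]; ring
    · simp only [preSurvival, survival_succ_succ]; ring
  simp only [payoff]
  rw [hsum, h1, survival_succ_succ, show a + (j + 2) + 1 = a + j + 3 by omega,
    show a + 1 + (j + 1) + 1 = a + j + 3 by omega, show a + 2 + j + 1 = a + j + 3 by omega,
    show a + (j + 2) = a + j + 2 by omega, show a + 1 + (j + 1) = a + j + 2 by omega,
    show a + 2 + j = a + j + 2 by omega]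
  module

/-- The payoff expected from the state `T`, given by the total length of the steps drawn, and the
length and height of the path under construction. -/
noncomputable def stateValue (n : ℕ) (T : ℕ × ℕ × ℤ) : E :=
  payoff φ ψ T.1 (n - T.2.1) (T.2.2 + 1).toNat

/-- One step of the sampler stopped when the target length is reached, together with the total
length of the steps drawn. -/
def stopStep (n : ℕ) (T : ℕ × ℕ × ℤ) (s : SchroderStep) : ℕ × ℕ × ℤ :=
  if T.2.1 = n then T else (T.1 + s.length, advance n T.2 s)

theorem stopStep_invariant {n : ℕ} {T : ℕ × ℕ × ℤ} (hT : T.2.1 ≤ n ∧ 0 ≤ T.2.2)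
    (s : SchroderStep) : (stopStep n T s).2.1 ≤ n ∧ 0 ≤ (stopStep n T s).2.2 := by
  unfold stopStep advance
  split_ifs with h1 h2
  · exact hT
  · simp
  · simp only [not_or, not_lt] at h2
    exact ⟨h2.2, h2.1⟩

theorem stopStep_of_restart {n : ℕ} {T : ℕ × ℕ × ℤ} {s : SchroderStep} (hn : T.2.1 ≠ n)
    (h : T.2.2 + s.rise < 0 ∨ n < T.2.1 + s.length) : stopStep n T s = (T.1 + s.length, 0, 0) := by
  rw [stopStep, if_neg hn, advance, if_pos h]

theorem stopStep_of_append {n : ℕ} {T : ℕ × ℕ × ℤ} {s : SchroderStep} (hn : T.2.1 ≠ n)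
    (h : ¬ (T.2.2 + s.rise < 0 ∨ n < T.2.1 + s.length)) :
    stopStep n T s = (T.1 + s.length, T.2.1 + s.length, T.2.2 + s.rise) := by
  rw [stopStep, if_neg hn, advance, if_neg h]

variable {φ ψ}

/-- The martingale property. Away from the target it is the first-step recursion of `payoff`; `hφ`
says that the amount paid upon failure is the value of the restarted state, so rejections fit the
same recursion. -/
theorem stateValue_eq_stopStep {n : ℕ} (hφ : ∀ a, φ a = payoff φ ψ a n 1) {T : ℕ × ℕ × ℤ}
    (hT : T.2.1 ≤ n ∧ 0 ≤ T.2.2) :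
    rho • stateValue φ ψ n (stopStep n T up) + rho • stateValue φ ψ n (stopStep n T down) +
      rho ^ 2 • stateValue φ ψ n (stopStep n T flat) = stateValue φ ψ n T := by
  obtain ⟨a, l, h⟩ := T
  obtain ⟨hl, hh⟩ := hT
  simp only at hl hh
  by_cases hn : l = n
  · simp only [stopStep, hn, if_true]
    rw [← add_smul, ← add_smul, rho_sq, show rho + rho + (1 - 2 * rho) = 1 by ring, one_smul]
  lift h to ℕ using hh
  obtain ⟨j, rfl⟩ : ∃ j, n = l + (j + 1) := ⟨n - l - 1, by omega⟩
  have e1 : stateValue φ ψ (l + (j + 1)) (stopStep (l + (j + 1)) (a, l, (h : ℤ)) up) =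
      payoff φ ψ (a + 1) j (h + 2) := by
    rw [stopStep_of_append hn (by simp only [rise, SchroderStep.length]; omega)]
    simp only [stateValue, rise, SchroderStep.length]
    congr 1; omega
  have e2 : stateValue φ ψ (l + (j + 1)) (stopStep (l + (j + 1)) (a, l, (h : ℤ)) down) =
      payoff φ ψ (a + 1) j h := by
    rcases h with _ | h
    · rw [stopStep_of_restart hn (by simp [rise]), payoff_zero_right, hφ]
      simp [stateValue, SchroderStep.length]
    · rw [stopStep_of_append hn (by simp only [rise, SchroderStep.length]; omega)]
      simp only [stateValue, rise, SchroderStep.length]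
      congr 1 <;> omega
  have e3 : stateValue φ ψ (l + (j + 1)) (stopStep (l + (j + 1)) (a, l, (h : ℤ)) flat) =
      if j = 0 then φ (a + 2) else payoff φ ψ (a + 2) (j - 1) (h + 1) := by
    by_cases hj : j = 0
    · rw [stopStep_of_restart hn (by simp only [rise, SchroderStep.length]; omega), if_pos hj, hφ]
      simp [stateValue, SchroderStep.length]
    · rw [stopStep_of_append hn (by simp only [rise, SchroderStep.length]; omega), if_neg hj]
      simp only [stateValue, rise, SchroderStep.length]
      congr 1; omega
  have e4 : stateValue φ ψ (l + (j + 1)) (a, l, (h : ℤ)) = payoff φ ψ a (j + 1) (h + 1) := by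
    simp only [stateValue]
    congr 1; omega
  rw [e1, e2, e3, e4]
  rcases j with _ | j
  · rw [payoff_one_succ, if_pos rfl]
  · rw [payoff_succ_succ, if_neg (by omega), Nat.add_sub_cancel]

end Payoff

/-- The sampler stopped when the target length is reached: total length of the steps drawn, length
and height of the path under construction. -/
def stopped (n : ℕ) (x : ℕ → SchroderStep) : ℕ → ℕ × ℕ × ℤ
  | 0 => (0, 0, 0)
  | k + 1 => stopStep n (stopped n x k) (x k)

theorem stopped_invariant (n : ℕ) (x : ℕ → SchroderStep) (k : ℕ) :
    (stopped n x k).2.1 ≤ n ∧ 0 ≤ (stopped n x k).2.2 := by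
  induction k with
  | zero => simp [stopped]
  | succ k ih => exact stopStep_invariant ih _

theorem stopped_congr {n : ℕ} {x y : ℕ → SchroderStep} {k : ℕ} (h : ∀ i < k, x i = y i) :
    stopped n x k = stopped n y k := by
  induction k with
  | zero => rfl
  | succ k ih => rw [stopped, stopped, ih fun i hi => h i (by omega), h k (by omega)]

theorem stopped_eq_of_forall_ne {n : ℕ} {x : ℕ → SchroderStep} {k : ℕ}
    (h : ∀ i < k, (state n x i).1 ≠ n) :
    stopped n x k = (∑ i ∈ Finset.range k, (x i).length, state n x k) := by
  induction k with
  | zero => rfl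
  | succ k ih =>
    rw [stopped, ih fun i hi => h i (by omega), stopStep, if_neg (h k (by omega)),
      Finset.sum_range_succ]
    rfl

theorem stopped_add_of_eq {n : ℕ} {x : ℕ → SchroderStep} {k : ℕ} (h : (stopped n x k).2.1 = n)
    (i : ℕ) : stopped n x (k + i) = stopped n x k := by
  induction i with
  | zero => rfl
  | succ i ih => rw [← add_assoc, stopped, ih, stopStep, if_pos h]

theorem stopped_of_halts {n : ℕ} {x : ℕ → SchroderStep} (h : Halts n x) {k : ℕ}
    (hk : haltTime n x ≤ k) :
    (stopped n x k).1 = drawnLength n x ∧ (stopped n x k).2.1 = n := by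
  have h1 : (state n x (haltTime n x)).1 = n := Nat.sInf_mem h
  have h2 : stopped n x (haltTime n x) = (drawnLength n x, state n x (haltTime n x)) :=
    stopped_eq_of_forall_ne fun i hi h' =>
      Nat.notMem_of_lt_sInf (s := {k | (state n x k).1 = n}) hi h'
  obtain ⟨i, rfl⟩ := Nat.exists_eq_add_of_le hk
  rw [stopped_add_of_eq (by rw [h2]; exact h1), h2]
  exact ⟨rfl, h1⟩

theorem one_le_length (s : SchroderStep) : 1 ≤ s.length := by
  cases s <;> simp [SchroderStep.length]

theorem le_stopped_of_not_halts {n : ℕ} {x : ℕ → SchroderStep} (h : ¬ Halts n x) (k : ℕ) :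
    k ≤ (stopped n x k).1 := by
  rw [stopped_eq_of_forall_ne fun i _ hi => h ⟨i, hi⟩]
  calc k = ∑ i ∈ Finset.range k, 1 := by simp
    _ ≤ _ := Finset.sum_le_sum fun i _ => one_le_length _

theorem stopped_fst_mono (n : ℕ) (x : ℕ → SchroderStep) : Monotone fun k => (stopped n x k).1 := by
  refine monotone_nat_of_le_succ fun k => ?_
  rw [stopped, stopStep]
  split_ifs
  · exact le_rfl
  · exact Nat.le_add_right _ _

instance : Fintype SchroderStep :=
  ⟨⟨{up, down, flat}, by simp⟩, by intro x; cases x <;> simp⟩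

instance : DiscreteMeasurableSpace SchroderStep := ⟨fun _ => trivial⟩

section Chain

variable {Ω : Type*} [MeasurableSpace Ω] {μ : Measure Ω} [IsProbabilityMeasure μ]
  {S : ℕ → Ω → SchroderStep}

/-- A sequence of steps that extends the given initial ones. -/
def extendSteps (k : ℕ) (y : Finset.range k → SchroderStep) (i : ℕ) : SchroderStep :=
  if h : i ∈ Finset.range k then y ⟨i, h⟩ else up

omit [MeasurableSpace Ω] in
theorem stopped_eq_extendSteps (n k : ℕ) (ω : Ω) : stopped n (fun i => S i ω) k =
    stopped n (extendSteps k fun i : Finset.range k => S i ω) k :=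
  stopped_congr fun i hi => by simp [extendSteps, hi]

theorem measurable_stopped (hS : ∀ i, Measurable (S i)) (n k : ℕ) :
    Measurable fun ω => stopped n (fun i => S i ω) k := by
  simp_rw [stopped_eq_extendSteps (S := S)]
  exact (Measurable.of_discrete (f := fun y => stopped n (extendSteps k y) k)).comp
    (measurable_pi_lambda _ fun i => hS i)

/-- The state after `k` draws depends on `k` steps only, hence takes finitely many values. -/
theorem integrable_comp_stopped {E : Type*} [NormedAddCommGroup E] (hS : ∀ i, Measurable (S i))
    (n k : ℕ) (g : ℕ × ℕ × ℤ → E) :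
    Integrable (fun ω => g (stopped n (fun i => S i ω) k)) μ := by
  simp_rw [stopped_eq_extendSteps (S := S)]
  have hm : Measurable fun (ω : Ω) (i : Finset.range k) => S i ω :=
    measurable_pi_lambda _ fun i => hS i
  have : IsProbabilityMeasure (μ.map fun (ω : Ω) (i : Finset.range k) => S i ω) :=
    Measure.isProbabilityMeasure_map hm.aemeasurable
  exact (Integrable.of_finite (μ := μ.map fun (ω : Ω) (i : Finset.range k) => S i ω)
    (f := fun y => g (stopped n (extendSteps k y) k))).comp_measurable hm

omit [IsProbabilityMeasure μ] in
theorem indepFun_stopped (hS : ∀ i, Measurable (S i)) (hindep : iIndepFun S μ) (n k : ℕ) :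
    IndepFun (S k) (fun ω => stopped n (fun i => S i ω) k) μ := by
  have h := hindep.indepFun_finset {k} (Finset.range k) (by simp) hS
  have h2 := h.comp (φ := fun y => y ⟨k, Finset.mem_singleton_self k⟩)
    (ψ := fun y => stopped n (extendSteps k y) k) .of_discrete .of_discrete
  convert! h2 using 1
  ext1 ω
  exact stopped_eq_extendSteps n k ω

/-- The Markov property: split on the value of step `k`, which is independent of the state built
from the earlier steps. -/
theorem integral_comp_stopped_succ {E : Type*} [NormedAddCommGroup E] [NormedSpace ℝ E]
    (hS : ∀ i, Measurable (S i)) (hindep : iIndepFun S μ)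
    (hlaw : ∀ i s, μ.real (S i ⁻¹' {s}) = s.weight) (n k : ℕ) (g : ℕ × ℕ × ℤ → E) :
    ∫ ω, g (stopped n (fun i => S i ω) (k + 1)) ∂μ =
      ∫ ω, rho • g (stopStep n (stopped n (fun i => S i ω) k) up) +
        rho • g (stopStep n (stopped n (fun i => S i ω) k) down) +
        rho ^ 2 • g (stopStep n (stopped n (fun i => S i ω) k) flat) ∂μ := by
  have hI : ∀ s, Integrable (fun ω => g (stopStep n (stopped n (fun i => S i ω) k) s)) μ :=
    fun s => integrable_comp_stopped hS n k fun T => g (stopStep n T s)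
  have hA : ∀ s, MeasurableSet (S k ⁻¹' {s}) := fun s => hS k trivial
  have key : ∀ s, ∫ ω, (S k ⁻¹' {s}).indicator
      (fun ω => g (stopStep n (stopped n (fun i => S i ω) k) s)) ω ∂μ =
      s.weight • ∫ ω, g (stopStep n (stopped n (fun i => S i ω) k) s) ∂μ := by
    intro s
    have h1 := (indepFun_stopped hS hindep n k).integral_fun_comp_smul_comp
      (f := Set.indicator {s} (1 : SchroderStep → ℝ)) (g := fun T => g (stopStep n T s))
      (hS k).aemeasurable (measurable_stopped hS n k).aemeasurable .of_discrete .of_discrete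
    have h2 : ∫ ω, Set.indicator {s} (1 : SchroderStep → ℝ) (S k ω) ∂μ = s.weight := by
      rw [← hlaw k s, ← integral_indicator_one (hA s)]
      rfl
    rw [h2] at h1
    rw [← h1]
    refine integral_congr_ae (ae_of_all _ fun ω => ?_)
    by_cases h : S k ω = s <;> simp [Set.indicator, h]
  have hsplit : ∀ ω, g (stopped n (fun i => S i ω) (k + 1)) = ∑ s : SchroderStep,
      (S k ⁻¹' {s}).indicator (fun ω => g (stopStep n (stopped n (fun i => S i ω) k) s)) ω := by
    intro ω
    rw [Finset.sum_eq_single (S k ω)]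
    · simp [stopped]
    · intro s _ hs
      exact Set.indicator_of_notMem (fun h => hs h.symm) _
    · simp
  simp_rw [hsplit]
  rw [integral_finsetSum _ fun s _ => (hI s).indicator (hA s), integral_add, integral_add,
    integral_smul, integral_smul, integral_smul]
  · simp_rw [key]
    change ∑ s ∈ ⟨{up, down, flat}, _⟩, _ = _
    simp [Finset.sum, weight, add_assoc]
  · exact (hI _).smul _
  · exact (hI _).smul _
  · exact ((hI _).smul _).add ((hI _).smul _)
  · exact (hI _).smul _

theorem integral_stateValue {E : Type*} [NormedAddCommGroup E] [NormedSpace ℝ E] [CompleteSpace E]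
    (hS : ∀ i, Measurable (S i)) (hindep : iIndepFun S μ)
    (hlaw : ∀ i s, μ.real (S i ⁻¹' {s}) = s.weight) {n : ℕ} {φ ψ : ℕ → E}
    (hφ : ∀ a, φ a = payoff φ ψ a n 1) (k : ℕ) :
    ∫ ω, stateValue φ ψ n (stopped n (fun i => S i ω) k) ∂μ = φ 0 := by
  induction k with
  | zero =>
    rw [hφ 0]
    simp [stopped, stateValue]
  | succ k ih =>
    rw [integral_comp_stopped_succ hS hindep hlaw, ← ih]
    refine integral_congr_ae (ae_of_all _ fun ω => ?_)
    exact stateValue_eq_stopStep hφ (stopped_invariant _ _ _)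

end Chain

end SchroderSampler

/-! ### Termination, exact mean and generating function of the drawn length -/

namespace SchroderSampler

open SchroderStep Topology

/-- The generating polynomial of the length of a failed attempt. -/
noncomputable def failPoly (n : ℕ) (z : ℂ) : ℂ :=
  ∑ m ∈ Finset.range (n + 1), (passage m 1 : ℂ) * z ^ m +
    ((rho ^ 2 * preSurvival n 1 : ℝ) : ℂ) * z ^ (n + 1)

/-- The probability generating function of the total drawn length. -/
noncomputable def drawnGenFun (n : ℕ) (z : ℂ) : ℂ :=
  survival n 1 * z ^ n / (1 - failPoly n z)

/-- The expectation of the total drawn length. -/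
noncomputable def drawnMean (n : ℕ) : ℝ :=
  (∑ m ∈ Finset.range (n + 1), passage m 1 * m + rho ^ 2 * preSurvival n 1 * (n + 1) +
    survival n 1 * n) / survival n 1

theorem drawnMean_nonneg (n : ℕ) : 0 ≤ drawnMean n := by
  have h1 := preSurvival_nonneg n 1
  have h2 := survival_nonneg n 1
  have h3 : 0 ≤ ∑ m ∈ Finset.range (n + 1), passage m 1 * (m : ℝ) :=
    Finset.sum_nonneg fun m _ => mul_nonneg (passage_nonneg _ _) m.cast_nonneg
  have h4 : (0 : ℝ) ≤ n + 1 := by positivity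
  exact div_nonneg (add_nonneg (add_nonneg h3 (mul_nonneg (mul_nonneg (sq_nonneg _) h1) h4))
    (mul_nonneg h2 n.cast_nonneg)) h2

theorem norm_failPoly_le (n : ℕ) {z : ℂ} (hz : ‖z‖ ≤ 1) : ‖failPoly n z‖ ≤ 1 - survival n 1 := by
  rw [← sum_passage_add n 1, add_sub_cancel_right, failPoly]
  refine (norm_add_le _ _).trans (add_le_add ((norm_sum_le _ _).trans ?_) ?_)
  · refine Finset.sum_le_sum fun m _ => ?_
    rw [norm_mul, Complex.norm_real, Real.norm_of_nonneg (passage_nonneg _ _), norm_pow]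
    exact mul_le_of_le_one_right (passage_nonneg _ _) (pow_le_one₀ (norm_nonneg _) hz)
  · have : 0 ≤ rho ^ 2 * preSurvival n 1 := mul_nonneg (sq_nonneg _) (preSurvival_nonneg _ _)
    rw [norm_mul, Complex.norm_real, Real.norm_of_nonneg this, norm_pow]
    exact mul_le_of_le_one_right this (pow_le_one₀ (norm_nonneg _) hz)

theorem one_sub_failPoly_ne_zero (n : ℕ) {z : ℂ} (hz : ‖z‖ ≤ 1) : 1 - failPoly n z ≠ 0 := by
  intro h
  have h1 := norm_failPoly_le n hz
  rw [← sub_eq_zero.1 h, norm_one] at h1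
  have := survival_pos n 0
  rw [zero_add] at this
  linarith

/-- The renewal equation `G = G F + u z ^ n` for the first attempt, multiplied by `z ^ a`. It makes
`b ↦ G z ^ b` an admissible failure payoff for the final payoff `z ^ b`. -/
theorem drawnGenFun_mul_pow_eq (n : ℕ) {z : ℂ} (hz : ‖z‖ ≤ 1) (a : ℕ) :
    drawnGenFun n z * z ^ a =
      payoff (fun b => drawnGenFun n z * z ^ b) (fun b => z ^ b) a n 1 := by
  have h := one_sub_failPoly_ne_zero n hz
  have h1 : drawnGenFun n z = drawnGenFun n z * failPoly n z + survival n 1 * z ^ n := by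
    unfold drawnGenFun
    field_simp
    ring
  simp only [payoff, Complex.real_smul]
  conv_lhs => rw [h1]
  rw [failPoly]
  simp only [mul_add, add_mul, Finset.mul_sum, Finset.sum_mul]
  congr 1
  · congr 1
    · refine Finset.sum_congr rfl fun m _ => ?_
      ring
    · ring
  · ring

/-- Wald's identity in fixed-point form: mean drawn length times success probability equals mean
length of one attempt. -/
theorem add_drawnMean_eq (n a : ℕ) : (a : ℝ) + drawnMean n =
    payoff (fun b => (b : ℝ) + drawnMean n) (fun b => (b : ℝ)) a n 1 := by
  have h := (survival_pos n 0).ne'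
  rw [zero_add] at h
  have h2 := sum_passage_add n 1
  have h1 : drawnMean n * survival n 1 = ∑ m ∈ Finset.range (n + 1), passage m 1 * (m : ℝ) +
      rho ^ 2 * preSurvival n 1 * (n + 1) + survival n 1 * n := by
    unfold drawnMean
    field_simp
  simp only [payoff, smul_eq_mul]
  have h3 : ∑ m ∈ Finset.range (n + 1), passage m 1 * (((a + m : ℕ) : ℝ) + drawnMean n) =
      (a + drawnMean n) * ∑ m ∈ Finset.range (n + 1), passage m 1 +
        ∑ m ∈ Finset.range (n + 1), passage m 1 * (m : ℝ) := by
    rw [Finset.mul_sum, ← Finset.sum_add_distrib]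
    refine Finset.sum_congr rfl fun m _ => ?_
    push_cast
    ring
  rw [h3]
  push_cast
  linear_combination (-(a : ℝ) - drawnMean n) * h2 + h1

theorem le_payoff_drawnMean (n a j k : ℕ) :
    (a : ℝ) ≤ payoff (fun b => (b : ℝ) + drawnMean n) (fun b => (b : ℝ)) a j k := by
  have h0 := drawnMean_nonneg n
  have hp : 0 ≤ rho ^ 2 * preSurvival j k := mul_nonneg (sq_nonneg _) (preSurvival_nonneg _ _)
  calc (a : ℝ) = ∑ m ∈ Finset.range (j + 1), passage m k * a + rho ^ 2 * preSurvival j k * a +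
        survival j k * a := by
        rw [← Finset.sum_mul, ← add_mul, ← add_mul, sum_passage_add, one_mul]
    _ ≤ _ := by
        simp only [payoff, smul_eq_mul]
        push_cast
        have := survival_nonneg j k
        gcongr with m
        · exact passage_nonneg _ _
        · have : (0 : ℝ) ≤ m := m.cast_nonneg
          linarith
        · have : (0 : ℝ) ≤ j := j.cast_nonneg
          linarith
        · have : (0 : ℝ) ≤ j := j.cast_nonneg
          linarith

theorem payoff_drawnMean_le (n a j k : ℕ) :
    payoff (fun b => (b : ℝ) + drawnMean n) (fun b => (b : ℝ)) a j k ≤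
      a + (j + 1 + drawnMean n) := by
  have h0 := drawnMean_nonneg n
  have hp : 0 ≤ rho ^ 2 * preSurvival j k := mul_nonneg (sq_nonneg _) (preSurvival_nonneg _ _)
  set c : ℝ := a + (j + 1 + drawnMean n) with hc
  calc _ ≤ ∑ m ∈ Finset.range (j + 1), passage m k * c + rho ^ 2 * preSurvival j k * c +
        survival j k * c := by
        simp only [payoff, smul_eq_mul]
        push_cast
        have := survival_nonneg j k
        gcongr with m hm
        · exact passage_nonneg _ _
        · have : (m : ℝ) + 1 ≤ j + 1 := by exact_mod_cast Finset.mem_range.1 hm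
          linarith
        · linarith
        · linarith
    _ = c := by rw [← Finset.sum_mul, ← add_mul, ← add_mul, sum_passage_add, one_mul]

theorem norm_payoff_pow_le (n : ℕ) {z : ℂ} (hz : ‖z‖ ≤ 1) (a j k : ℕ) :
    ‖payoff (fun b => drawnGenFun n z * z ^ b) (fun b => z ^ b) a j k‖ ≤
      1 + ‖drawnGenFun n z‖ := by
  have hp : 0 ≤ rho ^ 2 * preSurvival j k := mul_nonneg (sq_nonneg _) (preSurvival_nonneg _ _)
  have hs := survival_nonneg j k
  set c : ℝ := 1 + ‖drawnGenFun n z‖ with hc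
  have hpow : ∀ b, ‖z ^ b‖ ≤ 1 := fun b => by
    rw [norm_pow]; exact pow_le_one₀ (norm_nonneg _) hz
  have h1 : ∀ b, ‖drawnGenFun n z * z ^ b‖ ≤ c := fun b => by
    rw [norm_mul]
    have := mul_le_of_le_one_right (norm_nonneg (drawnGenFun n z)) (hpow b)
    linarith
  have h2 : ∀ b, ‖z ^ b‖ ≤ c := fun b => by
    have := norm_nonneg (drawnGenFun n z)
    linarith [hpow b]
  calc _ ≤ ∑ m ∈ Finset.range (j + 1), passage m k * c + rho ^ 2 * preSurvival j k * c +
        survival j k * c := by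
        refine (norm_add_le _ _).trans (add_le_add ((norm_add_le _ _).trans
          (add_le_add ((norm_sum_le _ _).trans (Finset.sum_le_sum fun m _ => ?_)) ?_)) ?_)
        · rw [norm_smul, Real.norm_of_nonneg (passage_nonneg _ _)]
          exact mul_le_mul_of_nonneg_left (h1 _) (passage_nonneg _ _)
        · rw [norm_smul, Real.norm_of_nonneg hp]
          exact mul_le_mul_of_nonneg_left (h1 _) hp
        · rw [norm_smul, Real.norm_of_nonneg hs]
          exact mul_le_mul_of_nonneg_left (h2 _) hs
    _ = c := by rw [← Finset.sum_mul, ← add_mul, ← add_mul, sum_passage_add, one_mul]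

section Chain

variable {Ω : Type*} [MeasurableSpace Ω] {μ : Measure Ω} [IsProbabilityMeasure μ]
  {S : ℕ → Ω → SchroderStep}

theorem integral_stopped_le (hS : ∀ i, Measurable (S i)) (hindep : iIndepFun S μ)
    (hlaw : ∀ i s, μ.real (S i ⁻¹' {s}) = s.weight) (n k : ℕ) :
    ∫ ω, ((stopped n (fun i => S i ω) k).1 : ℝ) ∂μ ≤ drawnMean n := by
  have h := integral_stateValue hS hindep hlaw (add_drawnMean_eq n) k
  rw [Nat.cast_zero, zero_add] at h
  rw [← h]
  exact integral_mono (integrable_comp_stopped hS n k fun T => (T.1 : ℝ))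
    (integrable_comp_stopped hS n k _) fun ω => le_payoff_drawnMean n _ _ _

/-- Every draw has length at least `1`, so without stopping the drawn length after `k` draws is at
least `k`; its mean stays below `drawnMean n`, and Markov's inequality applies for every `k`. -/
theorem ae_halts (hS : ∀ i, Measurable (S i)) (hindep : iIndepFun S μ)
    (hlaw : ∀ i s, μ.real (S i ⁻¹' {s}) = s.weight) (n : ℕ) :
    ∀ᵐ ω ∂μ, Halts n (fun i => S i ω) := by
  rw [ae_iff]
  set N : Set Ω := {ω | ¬ Halts n (fun i => S i ω)}
  have h : ∀ k : ℕ, (k : ℝ) * μ.real N ≤ drawnMean n := by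
    intro k
    calc (k : ℝ) * μ.real N
        ≤ k * μ.real {ω | (k : ℝ) ≤ ((stopped n (fun i => S i ω) k).1 : ℝ)} := by
          refine mul_le_mul_of_nonneg_left (measureReal_mono fun ω hω => ?_) k.cast_nonneg
          exact_mod_cast le_stopped_of_not_halts hω k
      _ ≤ ∫ ω, ((stopped n (fun i => S i ω) k).1 : ℝ) ∂μ :=
          mul_meas_ge_le_integral_of_nonneg (ae_of_all _ fun ω => Nat.cast_nonneg _)
            (integrable_comp_stopped hS n k fun T => (T.1 : ℝ)) _
      _ ≤ drawnMean n := integral_stopped_le hS hindep hlaw n k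
  have h0 : μ.real N = 0 := by
    by_contra hne
    have hpos : 0 < μ.real N := lt_of_le_of_ne measureReal_nonneg (Ne.symm hne)
    obtain ⟨k, hk⟩ := exists_nat_gt (drawnMean n / μ.real N)
    rw [div_lt_iff₀ hpos] at hk
    exact absurd (h k) (not_le.2 hk)
  rwa [measureReal_eq_zero_iff] at h0

theorem tendsto_comp_stopped {E : Type*} [TopologicalSpace E] {n : ℕ} {x : ℕ → SchroderStep}
    (hx : Halts n x) (g : ℕ → E) :
    Tendsto (fun k => g (stopped n x k).1) atTop (𝓝 (g (drawnLength n x))) := by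
  refine tendsto_const_nhds.congr' ?_
  filter_upwards [eventually_ge_atTop (haltTime n x)] with k hk
  rw [(stopped_of_halts hx hk).1]

theorem stopped_fst_le_drawnLength {n : ℕ} {x : ℕ → SchroderStep} (hx : Halts n x) (k : ℕ) :
    (stopped n x k).1 ≤ drawnLength n x := by
  rw [← (stopped_of_halts hx (le_max_left (haltTime n x) k)).1]
  exact stopped_fst_mono n x (le_max_right _ _)

theorem aestronglyMeasurable_drawnLength (hS : ∀ i, Measurable (S i)) (hindep : iIndepFun S μ)
    (hlaw : ∀ i s, μ.real (S i ⁻¹' {s}) = s.weight) (n : ℕ) :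
    AEStronglyMeasurable (fun ω => (drawnLength n (fun i => S i ω) : ℝ)) μ :=
  aestronglyMeasurable_of_tendsto_ae atTop
    (fun k => (integrable_comp_stopped (μ := μ) hS n k fun T => (T.1 : ℝ)).aestronglyMeasurable)
    ((ae_halts hS hindep hlaw n).mono fun _ hω => tendsto_comp_stopped hω _)

theorem integrable_drawnLength (hS : ∀ i, Measurable (S i)) (hindep : iIndepFun S μ)
    (hlaw : ∀ i s, μ.real (S i ⁻¹' {s}) = s.weight) (n : ℕ) :
    Integrable (fun ω => (drawnLength n (fun i => S i ω) : ℝ)) μ := by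
  refine ⟨aestronglyMeasurable_drawnLength hS hindep hlaw n, ?_⟩
  rw [hasFiniteIntegral_iff_ofReal (ae_of_all _ fun ω => Nat.cast_nonneg _)]
  have h := lintegral_tendsto_of_tendsto_of_monotone (μ := μ)
    (f := fun k ω => ENNReal.ofReal ((stopped n (fun i => S i ω) k).1 : ℝ))
    (F := fun ω => ENNReal.ofReal (drawnLength n (fun i => S i ω) : ℝ))
    (fun k => (integrable_comp_stopped (μ := μ) hS n k
      fun T => (T.1 : ℝ)).aestronglyMeasurable.aemeasurable.ennreal_ofReal)
    (ae_of_all _ fun ω i j hij =>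
      ENNReal.ofReal_le_ofReal (by exact_mod_cast stopped_fst_mono n _ hij))
    ((ae_halts hS hindep hlaw n).mono fun _ hω =>
      tendsto_comp_stopped hω fun b => ENNReal.ofReal (b : ℝ))
  refine (le_of_tendsto' h fun k => ?_).trans_lt (ENNReal.ofReal_lt_top (r := drawnMean n))
  rw [← ofReal_integral_eq_lintegral_ofReal (integrable_comp_stopped hS n k fun T => (T.1 : ℝ))
    (ae_of_all _ fun ω => Nat.cast_nonneg _)]
  exact ENNReal.ofReal_le_ofReal (integral_stopped_le hS hindep hlaw n k)

/-- Optional stopping: the value process has constant mean `φ 0` and is eventually equal to `ψ` of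
the drawn length, since at distance `0` the payoff is `ψ`. Dominated convergence exchanges limit and
mean. -/
theorem integral_comp_drawnLength {E : Type*} [NormedAddCommGroup E] [NormedSpace ℝ E]
    [CompleteSpace E] (hS : ∀ i, Measurable (S i)) (hindep : iIndepFun S μ)
    (hlaw : ∀ i s, μ.real (S i ⁻¹' {s}) = s.weight) {n : ℕ} {φ ψ : ℕ → E}
    (hφ : ∀ a, φ a = payoff φ ψ a n 1) {bound : Ω → ℝ} (hbound : Integrable bound μ)
    (hle : ∀ k, ∀ᵐ ω ∂μ, ‖stateValue φ ψ n (stopped n (fun i => S i ω) k)‖ ≤ bound ω) :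
    ∫ ω, ψ (drawnLength n (fun i => S i ω)) ∂μ = φ 0 := by
  refine tendsto_nhds_unique (tendsto_integral_of_dominated_convergence bound
    (fun k => (integrable_comp_stopped hS n k (stateValue φ ψ n)).aestronglyMeasurable)
    hbound hle ?_) ?_
  · filter_upwards [ae_halts hS hindep hlaw n] with ω hω
    refine tendsto_const_nhds.congr' ?_
    filter_upwards [eventually_ge_atTop (haltTime n fun i => S i ω)] with k hk
    obtain ⟨h1, h2⟩ := stopped_of_halts hω hk
    have h3 := (stopped_invariant n (fun i => S i ω) k).2
    rw [stateValue, h1, h2, Nat.sub_self, Int.toNat_add h3 zero_le_one, Int.toNat_one, payoff_zero_succ]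
  · simp_rw [integral_stateValue hS hindep hlaw hφ]
    exact tendsto_const_nhds

theorem integral_drawnLength (hS : ∀ i, Measurable (S i)) (hindep : iIndepFun S μ)
    (hlaw : ∀ i s, μ.real (S i ⁻¹' {s}) = s.weight) (n : ℕ) :
    ∫ ω, (drawnLength n (fun i => S i ω) : ℝ) ∂μ = drawnMean n := by
  have h := integral_comp_drawnLength hS hindep hlaw (add_drawnMean_eq n)
    (bound := fun ω => (drawnLength n (fun i => S i ω) : ℝ) + (n + 1 + drawnMean n))
    ((integrable_drawnLength hS hindep hlaw n).add (integrable_const _)) fun k => by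
      filter_upwards [ae_halts hS hindep hlaw n] with ω hω
      have h1 := le_payoff_drawnMean n (stopped n (fun i => S i ω) k).1
        (n - (stopped n (fun i => S i ω) k).2.1) ((stopped n (fun i => S i ω) k).2.2 + 1).toNat
      have h2 := payoff_drawnMean_le n (stopped n (fun i => S i ω) k).1
        (n - (stopped n (fun i => S i ω) k).2.1) ((stopped n (fun i => S i ω) k).2.2 + 1).toNat
      have h3 : (((stopped n (fun i => S i ω) k).1 : ℕ) : ℝ) ≤ drawnLength n (fun i => S i ω) := by
        exact_mod_cast stopped_fst_le_drawnLength hω k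
      have h4 : ((n - (stopped n (fun i => S i ω) k).2.1 : ℕ) : ℝ) ≤ n := by
        exact_mod_cast Nat.sub_le _ _
      have h5 : (0 : ℝ) ≤ ((stopped n (fun i => S i ω) k).1 : ℕ) := Nat.cast_nonneg _
      rw [stateValue, Real.norm_of_nonneg (h5.trans h1)]
      linarith
  simpa using h

theorem integral_pow_drawnLength (hS : ∀ i, Measurable (S i)) (hindep : iIndepFun S μ)
    (hlaw : ∀ i s, μ.real (S i ⁻¹' {s}) = s.weight) (n : ℕ) {z : ℂ} (hz : ‖z‖ ≤ 1) :
    ∫ ω, z ^ drawnLength n (fun i => S i ω) ∂μ = drawnGenFun n z := by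
  have h := integral_comp_drawnLength hS hindep hlaw (drawnGenFun_mul_pow_eq n hz)
    (integrable_const (1 + ‖drawnGenFun n z‖)) fun k =>
      ae_of_all _ fun ω => norm_payoff_pow_le n hz _ _ _
  simpa using h

theorem charFun_map_drawnLength_div (hS : ∀ i, Measurable (S i)) (hindep : iIndepFun S μ)
    (hlaw : ∀ i s, μ.real (S i ⁻¹' {s}) = s.weight) (n : ℕ) (t : ℝ) :
    charFun (μ.map fun ω => (drawnLength n (fun i => S i ω) : ℝ) / n) t =
      drawnGenFun n (Complex.exp ((t / n : ℝ) * Complex.I)) := by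
  have hm := (aestronglyMeasurable_drawnLength hS hindep hlaw n).aemeasurable.div_const (n : ℝ)
  rw [charFun_apply_real, integral_map hm (by fun_prop),
    ← integral_pow_drawnLength hS hindep hlaw n (Complex.norm_exp_ofReal_mul_I _).le]
  refine integral_congr_ae (ae_of_all _ fun ω => ?_)
  simp only [← Complex.exp_nat_mul]
  congr 1
  push_cast
  ring

end Chain

end SchroderSampler

/-! ### Real analysis: summation, convolution and central binomial asymptotics -/

open Topology

/-- **Stolz–Cesàro**, in summed form. -/
theorem tendsto_sum_range_div_sum_range {c d : ℕ → ℝ} {l : ℝ} (hd : ∀ n, 0 < d n)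
    (hsum : Tendsto (fun n => ∑ i ∈ Finset.range n, d i) atTop atTop)
    (h : Tendsto (fun n => c n / d n) atTop (𝓝 l)) :
    Tendsto (fun n => (∑ i ∈ Finset.range n, c i) / ∑ i ∈ Finset.range n, d i) atTop (𝓝 l) := by
  have h1 : (fun n => c n - l * d n) =o[atTop] d := by
    rw [isLittleO_iff_tendsto fun n hn => absurd hn (hd n).ne']
    have h2 := h.sub_const l
    rw [sub_self] at h2
    refine h2.congr fun n => ?_
    have := (hd n).ne'
    field_simp
  have h3 := (h1.sum_range (fun n => (hd n).le) hsum).tendsto_div_nhds_zero.add_const l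
  rw [zero_add] at h3
  refine h3.congr' ?_
  filter_upwards [hsum.eventually_gt_atTop 0] with n hn
  rw [Finset.sum_sub_distrib, ← Finset.mul_sum]
  have := hn.ne'
  field_simp
  ring

/-- After division by `m ^ a`, this is the difference quotient of `x ^ a` at `1` with increment `1 /
m`. -/
theorem tendsto_rpow_succ_sub_rpow (a : ℝ) :
    Tendsto (fun m : ℕ => (((m : ℝ) + 1) ^ a - (m : ℝ) ^ a) / (m : ℝ) ^ (a - 1)) atTop (𝓝 a) := by
  have h := (Real.hasDerivAt_rpow_const (x := 1) (p := a) (Or.inl one_ne_zero)).tendsto_slope_zero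
  have h1 : Tendsto (fun m : ℕ => ((m : ℝ))⁻¹) atTop (𝓝[≠] 0) := by
    refine tendsto_nhdsWithin_iff.2 ⟨tendsto_inv_atTop_nhds_zero_nat, ?_⟩
    filter_upwards [eventually_gt_atTop 0] with m hm
    simpa using hm.ne'
  have h2 := h.comp h1
  simp only [Real.one_rpow, mul_one] at h2
  refine h2.congr' ?_
  filter_upwards [eventually_gt_atTop 0] with m hm
  have hm' : (0 : ℝ) < m := by exact_mod_cast hm
  simp only [Function.comp, inv_inv, smul_eq_mul]
  rw [show 1 + (m : ℝ)⁻¹ = (m + 1) / m by field_simp, Real.div_rpow (by positivity) hm'.le,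
    Real.rpow_sub_one hm'.ne']
  have := Real.rpow_pos_of_pos hm' a
  field_simp

theorem tendsto_sqrt_mul_succ {a : ℕ → ℝ} {A : ℝ}
    (h : Tendsto (fun n : ℕ => √n * a n) atTop (𝓝 A)) (j : ℕ) :
    Tendsto (fun n : ℕ => √((n + j : ℕ) : ℝ) * a n) atTop (𝓝 A) := by
  have h1 : Tendsto (fun n : ℕ => √(1 + (j : ℝ) / n)) atTop (𝓝 1) := by
    have := ((tendsto_const_div_atTop_nhds_zero_nat (j : ℝ)).const_add 1).sqrt
    simpa using this
  have h2 := h1.mul h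
  rw [one_mul] at h2
  refine h2.congr' ?_
  filter_upwards [eventually_gt_atTop 0] with n hn
  have hn' : (0 : ℝ) < n := by exact_mod_cast hn
  rw [← mul_assoc, ← Real.sqrt_mul (by positivity)]
  congr 2
  push_cast
  field_simp

theorem tendsto_sqrt_mul_shift {a : ℕ → ℝ} {A : ℝ}
    (h : Tendsto (fun n : ℕ => √n * a n) atTop (𝓝 A)) (j : ℕ) :
    Tendsto (fun n : ℕ => √n * a (n - j)) atTop (𝓝 A) := by
  rw [← tendsto_add_atTop_iff_nat j]
  simpa using tendsto_sqrt_mul_succ h j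

theorem tendsto_sqrt_mul_add {a : ℕ → ℝ} {A : ℝ}
    (h : Tendsto (fun n : ℕ => √n * a n) atTop (𝓝 A)) (j : ℕ) :
    Tendsto (fun n : ℕ => √n * a (n + j)) atTop (𝓝 A) := by
  have h0 := (tendsto_add_atTop_iff_nat j).2 h
  have h1 : Tendsto (fun n : ℕ => √(n / (n + j : ℝ))) atTop (𝓝 1) := by
    have := (tendsto_natCast_div_add_atTop (j : ℝ)).sqrt
    simpa using this
  have h2 := h1.mul h0
  rw [one_mul] at h2
  refine h2.congr' ?_
  filter_upwards [eventually_gt_atTop 0] with n hn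
  have hn' : (0 : ℝ) < n := by exact_mod_cast hn
  rw [← mul_assoc, ← Real.sqrt_mul (by positivity)]
  congr 2
  push_cast
  field_simp

/-- Convolution of a sequence of order `n ^ (-1/2)` with a geometrically small one. -/
theorem tendsto_sqrt_mul_convolution {a b : ℕ → ℝ} {A r : ℝ} (hr0 : 0 ≤ r) (hr : r < 1)
    (hb : ∀ j, |b j| ≤ r ^ j) (h : Tendsto (fun n : ℕ => √n * a n) atTop (𝓝 A)) :
    Tendsto (fun n : ℕ => √n * ∑ j ∈ Finset.range (n + 1), b j * a (n - j)) atTop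
      (𝓝 (A * ∑' j, b j)) := by
  obtain ⟨M, hM⟩ := (tendsto_sqrt_mul_succ h 1).abs.bddAbove_range
  have hM' : ∀ n, √((n + 1 : ℕ) : ℝ) * |a n| ≤ M := fun n => by
    have := hM ⟨n, rfl⟩
    simpa [abs_mul, abs_of_nonneg (Real.sqrt_nonneg _)] using this
  have hM0 : 0 ≤ M := le_trans (by positivity) (hM' 0)
  have hsum : Summable fun j : ℕ => M * ((j + 1 : ℝ) * r ^ j) := by
    refine Summable.mul_left _ ?_
    have h1 := summable_pow_mul_geometric_of_norm_lt_one 1 (R := ℝ) (r := r)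
      (by rwa [Real.norm_of_nonneg hr0])
    have h2 := summable_geometric_of_lt_one hr0 hr
    refine (h1.add h2).congr fun j => ?_
    ring
  have key : Tendsto (fun n : ℕ => ∑' j, if j ≤ n then √n * (b j * a (n - j)) else 0) atTop
      (𝓝 (∑' j, A * b j)) := by
    refine tendsto_tsum_of_dominated_convergence hsum (fun j => ?_) (Eventually.of_forall ?_)
    · have h1 := (tendsto_sqrt_mul_shift h j).mul_const (b j)
      refine h1.congr' ?_
      filter_upwards [eventually_ge_atTop j] with n hn
      rw [if_pos hn]
      ring
    · intro n j
      split_ifs with hj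
      -- From `n ≤ (n - j + 1) (j + 1)`: the shift in `a (n - j)` costs at most a factor `j + 1`,
      -- which the geometric bound on `b j` absorbs.
      · have h1 : √(n : ℝ) ≤ √((n - j + 1 : ℕ) : ℝ) * (j + 1) := by
          calc √(n : ℝ) ≤ √(((n - j + 1 : ℕ) : ℝ) * (j + 1)) := by
                refine Real.sqrt_le_sqrt ?_
                push_cast [Nat.cast_sub hj]
                have : (j : ℝ) ≤ n := by exact_mod_cast hj
                nlinarith [mul_nonneg (sub_nonneg.2 this) (Nat.cast_nonneg (α := ℝ) j)]
            _ = √((n - j + 1 : ℕ) : ℝ) * √((j : ℝ) + 1) := Real.sqrt_mul (by positivity) _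
            _ ≤ _ := by
                refine mul_le_mul_of_nonneg_left ?_ (Real.sqrt_nonneg _)
                rw [Real.sqrt_le_left (by positivity)]
                nlinarith [Nat.cast_nonneg (α := ℝ) j]
        rw [Real.norm_eq_abs, abs_mul, abs_mul, abs_of_nonneg (Real.sqrt_nonneg _)]
        calc √(n : ℝ) * (|b j| * |a (n - j)|)
            ≤ (√((n - j + 1 : ℕ) : ℝ) * (j + 1)) * (r ^ j * |a (n - j)|) := by
              gcongr
              exact hb j
          _ = (√((n - j + 1 : ℕ) : ℝ) * |a (n - j)|) * ((j + 1) * r ^ j) := by ring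
          _ ≤ _ := by
              gcongr
              exact hM' _
      · rw [norm_zero]
        positivity
  rw [tsum_mul_left] at key
  refine key.congr fun n => ?_
  rw [tsum_eq_sum (s := Finset.range (n + 1)), Finset.mul_sum]
  · refine Finset.sum_congr rfl fun j hj => ?_
    rw [if_pos (by simpa [Nat.lt_succ_iff] using hj)]
  · intro j hj
    rw [if_neg (by simpa [Nat.lt_succ_iff] using hj)]

theorem centralBinom_div_four_pow_eq_stirlingSeq {n : ℕ} (hn : n ≠ 0) :
    √(n : ℝ) * ((n.centralBinom : ℝ) / 4 ^ n) =
      Stirling.stirlingSeq (2 * n) / Stirling.stirlingSeq n ^ 2 := by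
  have h1 : ((2 * n).factorial : ℝ) = n.centralBinom * n.factorial * n.factorial := by
    have := Nat.choose_mul_factorial_mul_factorial (show n ≤ 2 * n by omega)
    rw [show 2 * n - n = n by omega, ← Nat.centralBinom_eq_two_mul_choose] at this
    exact_mod_cast this.symm
  have hn' : (0 : ℝ) < n := by positivity
  have h2 : √(2 * ((2 * n : ℕ) : ℝ)) = 2 * √(n : ℝ) := by
    rw [Nat.cast_mul, show (2 : ℝ) * ((2 : ℕ) * (n : ℝ)) = 2 ^ 2 * n by push_cast; ring,
      Real.sqrt_mul (by positivity), Real.sqrt_sq (by positivity)]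
  have h3 : √(2 * (n : ℝ)) ^ 2 = 2 * n := Real.sq_sqrt (by positivity)
  have h4 : √(n : ℝ) ^ 2 = n := Real.sq_sqrt (by positivity)
  have h5 : (0 : ℝ) < n.factorial := by positivity
  have h6 : 0 < √(n : ℝ) := Real.sqrt_pos.2 hn'
  have h7 : 0 < (n : ℝ) / Real.exp 1 := by positivity
  unfold Stirling.stirlingSeq
  have h9 : ((2 * n : ℕ) : ℝ) / Real.exp 1 = 2 * ((n : ℝ) / Real.exp 1) := by push_cast; ring
  have h10 : (2 : ℝ) ^ (2 * n) = 4 ^ n := by rw [pow_mul]; norm_num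
  rw [h1, h2, h9, mul_pow, h10, div_pow _ (√(2 * (n : ℝ)) * _), mul_pow (√(2 * (n : ℝ))), h3,
    ← pow_mul, mul_comm n 2]
  have h8 : 0 < ((n : ℝ) / Real.exp 1) ^ (2 * n) := by positivity
  generalize ((n : ℝ) / Real.exp 1) ^ (2 * n) = w at *
  field_simp
  linear_combination (n.centralBinom : ℝ) * h4

theorem tendsto_sqrt_mul_centralBinom :
    Tendsto (fun n : ℕ => √(n : ℝ) * ((n.centralBinom : ℝ) / 4 ^ n)) atTop
      (𝓝 (√Real.pi / √Real.pi ^ 2)) := by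
  have h := Stirling.tendsto_stirlingSeq_sqrt_pi
  have h2 : Tendsto (fun n : ℕ => Stirling.stirlingSeq (2 * n)) atTop (𝓝 (√Real.pi)) :=
    h.comp (tendsto_id.const_mul_atTop' (by norm_num))
  have h3 := h2.div (h.pow 2) (by positivity)
  refine h3.congr' ?_
  filter_upwards [eventually_ne_atTop 0] with n hn
  exact (centralBinom_div_four_pow_eq_stirlingSeq hn).symm

/-! ### Asymptotics of survival and of truncated passage moments -/

namespace SchroderSampler

open SchroderStep

theorem exists_tendsto_sqrt_mul_centralCoeff :
    ∃ A : ℝ, 0 < A ∧ Tendsto (fun n : ℕ => √(n : ℝ) * centralCoeff n) atTop (𝓝 A) := by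
  refine ⟨√2 * (√Real.pi / √Real.pi ^ 2), by positivity, ?_⟩
  have hk : Tendsto (fun n : ℕ => n / 2) atTop atTop := Nat.tendsto_div_const_atTop (by norm_num)
  have h1 := tendsto_sqrt_mul_centralBinom.comp hk
  have h2 : Tendsto (fun n : ℕ => √((n : ℝ) / ((n / 2 : ℕ) : ℝ))) atTop (𝓝 (√2)) := by
    refine Tendsto.sqrt ?_
    have h3 : Tendsto (fun n : ℕ => 2 + 1 / ((n / 2 : ℕ) : ℝ)) atTop (𝓝 (2 + 0)) :=
      (tendsto_one_div_atTop_nhds_zero_nat.comp hk).const_add 2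
    rw [add_zero] at h3
    refine tendsto_of_tendsto_of_tendsto_of_le_of_le' tendsto_const_nhds h3 ?_ ?_
    · filter_upwards [eventually_ge_atTop 2] with n hn
      have : (0 : ℝ) < ((n / 2 : ℕ) : ℝ) := by exact_mod_cast Nat.div_pos hn (by norm_num)
      rw [le_div_iff₀ this]
      exact_mod_cast Nat.mul_div_le n 2
    · filter_upwards [eventually_ge_atTop 2] with n hn
      have : (0 : ℝ) < ((n / 2 : ℕ) : ℝ) := by exact_mod_cast Nat.div_pos hn (by norm_num)
      rw [div_le_iff₀ this, add_mul, one_div, inv_mul_cancel₀ this.ne']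
      exact_mod_cast show n ≤ 2 * (n / 2) + 1 by omega
  refine (h2.mul h1).congr' ?_
  filter_upwards [eventually_ge_atTop 2] with n hn
  have : (0 : ℝ) < ((n / 2 : ℕ) : ℝ) := by exact_mod_cast Nat.div_pos hn (by norm_num)
  rw [Function.comp, ← mul_assoc, ← Real.sqrt_mul (by positivity), div_mul_cancel₀ _ this.ne',
    centralCoeff]

theorem centralCoeff_nonneg (n : ℕ) : 0 ≤ centralCoeff n := by
  unfold centralCoeff
  positivity

theorem centralCoeff_le_one (n : ℕ) : centralCoeff n ≤ 1 := by
  unfold centralCoeff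
  generalize n / 2 = k
  induction k with
  | zero => simp
  | succ k ih =>
    have h := centralBinom_div_succ k
    have : (0 : ℝ) ≤ k := k.cast_nonneg
    by_contra hlt
    rw [not_le] at hlt
    nlinarith

theorem rho_sq_lt : rho ^ 2 < 1 / 4 := by
  have := rho_pos
  have := rho_lt_half
  nlinarith

theorem abs_coeff_rescale_le (j : ℕ) : |(-rho ^ 2) ^ j * centralCoeff j| ≤ (rho ^ 2) ^ j := by
  rw [abs_mul, abs_pow, abs_neg, abs_of_nonneg (sq_nonneg rho),
    abs_of_nonneg (centralCoeff_nonneg j)]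
  exact mul_le_of_le_one_right (by positivity) (centralCoeff_le_one j)

/-- The term `j = 0` is `1` and the others add up to less than `1` in absolute value, as `ρ² < 1/4`.
This keeps the constant `c` positive. -/
theorem tsum_coeff_rescale_pos : 0 < ∑' j, (-rho ^ 2) ^ j * centralCoeff j := by
  have hr := rho_sq_lt
  have hr0 := sq_nonneg rho
  have hg := summable_geometric_of_lt_one hr0 (by linarith)
  have hs : Summable fun j => (-rho ^ 2) ^ j * centralCoeff j :=
    Summable.of_norm_bounded hg abs_coeff_rescale_le
  have h1 : |∑' j, (-rho ^ 2) ^ (j + 1) * centralCoeff (j + 1)| ≤ (1 - rho ^ 2)⁻¹ - 1 := by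
    have h2 : HasSum (fun j => (rho ^ 2) ^ (j + 1)) ((1 - rho ^ 2)⁻¹ - 1) := by
      have := (hasSum_nat_add_iff' 1).2 (hasSum_geometric_of_lt_one hr0 (by linarith))
      simpa using this
    rw [← Real.norm_eq_abs]
    exact tsum_of_norm_bounded h2 fun j => abs_coeff_rescale_le (j + 1)
  have h3 : (1 - rho ^ 2)⁻¹ - 1 < 1 := by
    rw [sub_lt_iff_lt_add, inv_lt_comm₀ (by linarith) (by norm_num)]
    norm_num
    linarith
  rw [hs.tsum_eq_zero_add]
  have := (abs_le.1 h1).1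
  simp only [pow_zero, one_mul]
  rw [show centralCoeff 0 = 1 by simp [centralCoeff]]
  linarith

/-- The survival probability is of order `n ^ (-1/2)`. -/
theorem exists_tendsto_sqrt_mul_survival :
    ∃ c : ℝ, 0 < c ∧ Tendsto (fun n : ℕ => √(n : ℝ) * survival n 1) atTop (𝓝 c) := by
  obtain ⟨A, hA, h⟩ := exists_tendsto_sqrt_mul_centralCoeff
  have hr := rho_pos
  have h1 := tendsto_sqrt_mul_convolution (sq_nonneg rho) (by linarith [rho_sq_lt])
    abs_coeff_rescale_le h
  have h2 : Tendsto (fun n : ℕ => √(n : ℝ) * PowerSeries.coeff n ratioSeries) atTop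
      (𝓝 (A * ∑' j, (-rho ^ 2) ^ j * centralCoeff j)) := by
    refine h1.congr fun n => ?_
    rw [coeff_ratioSeries, ← Finset.Nat.sum_antidiagonal_swap,
      Finset.Nat.sum_antidiagonal_eq_sum_range_succ_mk]
    congr 1
    refine Finset.sum_congr rfl fun j _ => ?_
    simp only [Prod.swap]
    ring
  have h3 := (tendsto_sqrt_mul_add h2 1).div_const (2 * rho)
  refine ⟨_, div_pos (mul_pos hA tsum_coeff_rescale_pos) (by positivity), h3.congr fun n => ?_⟩
  rw [← survival_eq_ratioSeries]
  field_simp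

theorem tendsto_sqrt_mul_preSurvival {c : ℝ}
    (h : Tendsto (fun n : ℕ => √(n : ℝ) * survival n 1) atTop (𝓝 c)) :
    Tendsto (fun n : ℕ => √(n : ℝ) * preSurvival n 1) atTop (𝓝 c) := by
  refine (tendsto_sqrt_mul_shift h 1).congr' ?_
  filter_upwards [eventually_gt_atTop 0] with n hn
  obtain ⟨n, rfl⟩ := Nat.exists_eq_add_of_lt hn
  simp [preSurvival]

/-- The probability that a path reaches length `n` or jumps over it. -/
noncomputable def passageTail (n : ℕ) : ℝ := rho ^ 2 * preSurvival n 1 + survival n 1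

theorem passageTail_pos (n : ℕ) : 0 < passageTail n :=
  add_pos_of_nonneg_of_pos (mul_nonneg (sq_nonneg _) (preSurvival_nonneg _ _)) (survival_pos n 0)

theorem sum_passage_add_passageTail (n : ℕ) :
    ∑ m ∈ Finset.range (n + 1), passage m 1 + passageTail n = 1 := by
  rw [← sum_passage_add n 1, passageTail, add_assoc]

theorem passageTail_le_one (n : ℕ) : passageTail n ≤ 1 := by
  rw [← sum_passage_add_passageTail n, le_add_iff_nonneg_left]
  exact Finset.sum_nonneg fun m _ => passage_nonneg m 1

theorem tendsto_sqrt_mul_passageTail {c : ℝ}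
    (h : Tendsto (fun n : ℕ => √(n : ℝ) * survival n 1) atTop (𝓝 c)) :
    Tendsto (fun n : ℕ => √(n : ℝ) * passageTail n) atTop (𝓝 ((1 + rho ^ 2) * c)) := by
  have := ((tendsto_sqrt_mul_preSurvival h).const_mul (rho ^ 2)).add h
  rw [show rho ^ 2 * c + c = (1 + rho ^ 2) * c by ring] at this
  refine this.congr fun n => ?_
  rw [passageTail]
  ring

/-- Abel summation, the passage probabilities being the decrements of `passageTail`. -/
theorem sum_passage_mul_pow_succ (k n : ℕ) :
    ∑ m ∈ Finset.range (n + 1), passage m 1 * (m : ℝ) ^ (k + 1) =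
      ∑ m ∈ Finset.range n, passageTail m * (((m : ℝ) + 1) ^ (k + 1) - (m : ℝ) ^ (k + 1)) -
        passageTail n * (n : ℝ) ^ (k + 1) := by
  induction n with
  | zero => simp
  | succ n ih =>
    have h1 := sum_passage_add_passageTail n
    have h2 := sum_passage_add_passageTail (n + 1)
    rw [Finset.sum_range_succ] at h2
    rw [Finset.sum_range_succ, ih, Finset.sum_range_succ _ n]
    push_cast
    linear_combination ((n : ℝ) + 1) ^ (k + 1) * (h2 - h1)

/-- The rescaled moments of the passage distribution truncated at `n`. -/
noncomputable def passageMoment (n k : ℕ) : ℝ :=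
  √(n : ℝ) * ∑ m ∈ Finset.range (n + 1), passage m 1 * ((m : ℝ) / n) ^ (k + 1)

/-- After Abel summation the summand is equivalent to `c (k + 1) m ^ (k - 1/2)`. Stolz–Cesàro
against the increments of `m ^ a`, `a = k + 1/2`, gives `c (k + 1) / a`; the boundary term removes
`c`, leaving `c (1/2) / a`. -/
theorem tendsto_passageMoment {c : ℝ}
    (h : Tendsto (fun n : ℕ => √(n : ℝ) * passageTail n) atTop (𝓝 c)) (k : ℕ) :
    Tendsto (fun n => passageMoment n k) atTop (𝓝 (c * ((1 / 2) / ((k + 1 : ℝ) - 1 / 2)))) := by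
  set a : ℝ := (k + 1 : ℝ) - 1 / 2 with ha
  have ha0 : 0 < a := by
    have : (0 : ℝ) ≤ k := k.cast_nonneg
    linarith
  set d : ℕ → ℝ := fun m => ((m : ℝ) + 1) ^ a - (m : ℝ) ^ a with hd
  have hsumd : ∀ n, ∑ m ∈ Finset.range n, d m = (n : ℝ) ^ a := by
    intro n
    have := Finset.sum_range_sub (fun m : ℕ => (m : ℝ) ^ a) n
    simp only [Nat.cast_zero, Real.zero_rpow ha0.ne', sub_zero, Nat.cast_succ] at this
    exact this
  have hratio : Tendsto (fun m : ℕ => passageTail m *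
      (((m : ℝ) + 1) ^ (k + 1) - (m : ℝ) ^ (k + 1)) / d m) atTop (𝓝 (c * ((k + 1 : ℝ) / a))) := by
    have h1 := tendsto_rpow_succ_sub_rpow a
    have h2 := tendsto_rpow_succ_sub_rpow (k + 1 : ℝ)
    refine (h.mul (h2.div h1 ha0.ne')).congr' ?_
    filter_upwards [eventually_gt_atTop 0] with m hm
    have hm' : (0 : ℝ) < m := by exact_mod_cast hm
    have h3 : ((m : ℝ)) ^ ((k + 1 : ℝ) - 1) = √(m : ℝ) * (m : ℝ) ^ (a - 1) := by
      rw [Real.sqrt_eq_rpow, ← Real.rpow_add hm', ha]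
      congr 1
      ring
    have h4 : ∀ x : ℝ, x ^ (k + 1 : ℝ) = x ^ (k + 1) := fun x => by
      rw [← Real.rpow_natCast]; push_cast; rfl
    have h5 : 0 < √(m : ℝ) := Real.sqrt_pos.2 hm'
    have h6 : 0 < (m : ℝ) ^ (a - 1) := Real.rpow_pos_of_pos hm' _
    have h7 : 0 < d m := sub_pos.2 (Real.rpow_lt_rpow hm'.le (lt_add_one _) ha0)
    simp only [Pi.div_apply]
    rw [h3, h4, h4]
    change _ * (_ / (d m / _)) = _
    field_simp
  have hS := tendsto_sum_range_div_sum_range (d := d)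
    (fun m => sub_pos.2 (Real.rpow_lt_rpow m.cast_nonneg (lt_add_one _) ha0))
    (by simp_rw [hsumd]; exact (tendsto_rpow_atTop ha0).comp tendsto_natCast_atTop_atTop) hratio
  have hL := hS.sub h
  rw [show c * ((k + 1 : ℝ) / a) - c = c * ((1 / 2) / a) by
    field_simp
    rw [ha]
    ring] at hL
  refine hL.congr' ?_
  filter_upwards [eventually_gt_atTop 0] with n hn
  have hn' : (0 : ℝ) < n := by exact_mod_cast hn
  have h1 : √(n : ℝ) * (n : ℝ) ^ a = (n : ℝ) ^ (k + 1) := by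
    rw [Real.sqrt_eq_rpow, ← Real.rpow_add hn', ← Real.rpow_natCast, ha]
    congr 1
    push_cast
    ring
  have h2 : 0 < (n : ℝ) ^ a := Real.rpow_pos_of_pos hn' _
  have h3 : 0 < √(n : ℝ) := Real.sqrt_pos.2 hn'
  rw [hsumd, passageMoment]
  simp_rw [div_pow, mul_div_assoc']
  rw [← Finset.sum_div, sum_passage_mul_pow_succ, ← h1]
  field_simp

theorem passageMoment_nonneg (n k : ℕ) : 0 ≤ passageMoment n k := by
  refine mul_nonneg (Real.sqrt_nonneg _) (Finset.sum_nonneg fun m _ => ?_)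
  have := passage_nonneg m 1
  positivity

theorem passageMoment_le (n k : ℕ) : passageMoment n k ≤ passageMoment n 0 := by
  refine mul_le_mul_of_nonneg_left (Finset.sum_le_sum fun m hm => ?_) (Real.sqrt_nonneg _)
  refine mul_le_mul_of_nonneg_left ?_ (passage_nonneg m 1)
  rw [zero_add]
  refine pow_le_pow_of_le_one (by positivity) ?_ (by omega)
  exact div_le_one_of_le₀ (by exact_mod_cast Nat.lt_succ_iff.1 (Finset.mem_range.1 hm))
    n.cast_nonneg

end SchroderSampler

/-! ### The Darling–Mandelbrot series -/

open Topology

/-- The series in the definition of the characteristic function of the Darling–Mandelbrot law. -/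
noncomputable def darlingMandelbrotSeries (α s : ℝ) : ℂ :=
  ∑' m : ℕ, (α : ℂ) / ((m + 1 : ℂ) - α) * (Complex.I * s) ^ (m + 1) / ((m + 1).factorial : ℂ)

theorem darlingMandelbrotCharFun_eq (α s : ℝ) :
    darlingMandelbrotCharFun α s = (1 - darlingMandelbrotSeries α s)⁻¹ := rfl

theorem hasSum_pow_succ_div_factorial (z : ℂ) :
    HasSum (fun k : ℕ => z ^ (k + 1) / ((k + 1).factorial : ℂ)) (Complex.exp z - 1) := by
  have h := (hasSum_nat_add_iff' 1).2 (NormedSpace.expSeries_div_hasSum_exp z)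
  rw [Complex.exp_eq_exp_ℂ]
  simpa using h

theorem summable_norm_pow_succ_div_factorial (x : ℝ) :
    Summable fun k : ℕ => x ^ (k + 1) / ((k + 1).factorial : ℝ) :=
  (summable_nat_add_iff 1).2 (Real.summable_pow_div_factorial x)

theorem half_div_succ_sub_half_le_one (m : ℕ) :
    0 ≤ (1 / 2 : ℝ) / ((m + 1 : ℝ) - 1 / 2) ∧ (1 / 2 : ℝ) / ((m + 1 : ℝ) - 1 / 2) ≤ 1 := by
  have : (0 : ℝ) ≤ m := m.cast_nonneg
  have h : (0 : ℝ) < (m + 1 : ℝ) - 1 / 2 := by linarith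
  refine ⟨by positivity, ?_⟩
  rw [div_le_one h]
  linarith

theorem continuousAt_darlingMandelbrotSeries_half :
    ContinuousAt (darlingMandelbrotSeries (1 / 2)) 0 := by
  have h0 : darlingMandelbrotSeries (1 / 2) 0 = 0 := by
    simp [darlingMandelbrotSeries]
  have hle : ∀ s, ‖darlingMandelbrotSeries (1 / 2) s‖ ≤ Real.exp |s| - 1 := by
    intro s
    have h1 : HasSum (fun k : ℕ => |s| ^ (k + 1) / ((k + 1).factorial : ℝ)) (Real.exp |s| - 1) := by
      have h := (hasSum_nat_add_iff' 1).2 (NormedSpace.expSeries_div_hasSum_exp |s|)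
      rw [Real.exp_eq_exp_ℝ]
      simpa using h
    refine tsum_of_norm_bounded h1 fun m => ?_
    have h2 := half_div_succ_sub_half_le_one m
    have h3 : ((1 / 2 : ℝ) : ℂ) / ((m + 1 : ℂ) - (1 / 2 : ℝ)) =
        (((1 / 2 : ℝ) / ((m + 1 : ℝ) - 1 / 2) : ℝ) : ℂ) := by push_cast; rfl
    rw [h3, norm_div, norm_mul, Complex.norm_real, Real.norm_of_nonneg h2.1, norm_pow, norm_mul,
      Complex.norm_I, one_mul, Complex.norm_real, Real.norm_eq_abs, Complex.norm_natCast]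
    gcongr
    exact mul_le_of_le_one_left (by positivity) h2.2
  rw [ContinuousAt, h0]
  refine squeeze_zero_norm hle ?_
  have : Continuous fun s : ℝ => Real.exp |s| - 1 := by fun_prop
  simpa using this.tendsto 0

/-! ### Limits of the generating function and of the mean -/

namespace SchroderSampler

open SchroderStep

/-- The failure defect `∑_{m ≤ n} f_m (1 - z ^ m)` where `f` is the passage distribution. -/
noncomputable def passageDefect (n : ℕ) (z : ℂ) : ℂ :=
  ∑ m ∈ Finset.range (n + 1), (passage m 1 : ℂ) * (1 - z ^ m)

theorem one_sub_failPoly (n : ℕ) (z : ℂ) : 1 - failPoly n z =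
    survival n 1 + passageDefect n z + rho ^ 2 * preSurvival n 1 * (1 - z ^ (n + 1)) := by
  have h : (∑ m ∈ Finset.range (n + 1), (passage m 1 : ℂ)) + (rho : ℂ) ^ 2 * preSurvival n 1 +
      survival n 1 = 1 := by exact_mod_cast congrArg Complex.ofReal (sum_passage_add n 1)
  simp only [failPoly, passageDefect, mul_sub, mul_one, Finset.sum_sub_distrib]
  push_cast
  linear_combination -h

theorem re_passageDefect_nonneg (n : ℕ) {z : ℂ} (hz : ‖z‖ ≤ 1) : 0 ≤ (passageDefect n z).re := by
  rw [passageDefect, Complex.re_sum]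
  refine Finset.sum_nonneg fun m _ => ?_
  rw [Complex.re_ofReal_mul, Complex.sub_re, Complex.one_re]
  refine mul_nonneg (passage_nonneg m 1) (sub_nonneg.2 ((Complex.re_le_norm _).trans ?_))
  rw [norm_pow]
  exact pow_le_one₀ (norm_nonneg _) hz

theorem hasSum_passageDefect (n : ℕ) (t : ℝ) :
    HasSum (fun k => (passageMoment n k : ℂ) *
      ((Complex.I * t) ^ (k + 1) / ((k + 1).factorial : ℂ)))
      (-(√(n : ℝ) * passageDefect n (Complex.exp ((t / n : ℝ) * Complex.I)))) := by
  have h : HasSum (fun k : ℕ => ∑ m ∈ Finset.range (n + 1), (√(n : ℝ) : ℂ) * (passage m 1 *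
      ((m * ((t / n : ℝ) * Complex.I)) ^ (k + 1) / ((k + 1).factorial : ℂ))))
      (∑ m ∈ Finset.range (n + 1), (√(n : ℝ) : ℂ) * (passage m 1 *
        (Complex.exp (m * ((t / n : ℝ) * Complex.I)) - 1))) :=
    hasSum_sum fun m _ => ((hasSum_pow_succ_div_factorial _).mul_left _).mul_left _
  convert! h using 1
  · ext1 k
    rw [passageMoment]
    push_cast
    rw [Finset.mul_sum, Finset.sum_mul]
    refine Finset.sum_congr rfl fun m _ => ?_
    rw [show (m : ℂ) * (t / n * Complex.I) = (m / n) * (Complex.I * t) by ring, mul_pow _ _ (k + 1)]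
    ring
  · rw [passageDefect, Finset.mul_sum, ← Finset.sum_neg_distrib]
    refine Finset.sum_congr rfl fun m _ => ?_
    rw [Complex.exp_nat_mul]
    ring

/-- Expanding the exponentials turns the scaled defect into minus a power series in `i t` whose
coefficients are the passage moments. The moments all lie below the one of index `0`, which is
bounded in `n`, so the limit may be taken termwise. -/
theorem tendsto_sqrt_mul_passageDefect {c : ℝ}
    (h : Tendsto (fun n : ℕ => √(n : ℝ) * passageTail n) atTop (𝓝 c)) (t : ℝ) :
    Tendsto (fun n : ℕ => (√(n : ℝ) : ℂ) *
      passageDefect n (Complex.exp ((t / n : ℝ) * Complex.I))) atTop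
      (𝓝 (-(c * darlingMandelbrotSeries (1 / 2) t))) := by
  obtain ⟨M, hM⟩ := (tendsto_passageMoment h 0).bddAbove_range
  have hbound : ∀ n k, ‖(passageMoment n k : ℂ) *
      ((Complex.I * t) ^ (k + 1) / ((k + 1).factorial : ℂ))‖ ≤
      M * (|t| ^ (k + 1) / ((k + 1).factorial : ℝ)) := by
    intro n k
    rw [norm_mul, norm_div, norm_pow, norm_mul, Complex.norm_I, one_mul, Complex.norm_real,
      Complex.norm_real, Real.norm_eq_abs t, Complex.norm_natCast,
      Real.norm_of_nonneg (passageMoment_nonneg n k)]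
    exact mul_le_mul_of_nonneg_right ((passageMoment_le n k).trans (hM ⟨n, rfl⟩)) (by positivity)
  have key := tendsto_tsum_of_dominated_convergence
    ((summable_norm_pow_succ_div_factorial |t|).mul_left M)
    (fun k => ((Complex.continuous_ofReal.tendsto _).comp (tendsto_passageMoment h k)).mul_const
      ((Complex.I * t) ^ (k + 1) / ((k + 1).factorial : ℂ)))
    (Eventually.of_forall fun n k => hbound n k)
  have h2 := key.neg
  convert! h2 using 1
  · ext1 n
    simp only [Function.comp_apply]
    rw [(hasSum_passageDefect n t).tsum_eq, neg_neg]
  · rw [darlingMandelbrotSeries, ← tsum_mul_left]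
    congr 3
    ext1 k
    push_cast
    ring

/-- Up to a positive factor, the negative of the series is a limit of sums of `f_m (1 - z ^ m)` with
`f_m ≥ 0` and `‖z‖ = 1`. -/
theorem re_darlingMandelbrotSeries_half_nonpos (t : ℝ) :
    (darlingMandelbrotSeries (1 / 2) t).re ≤ 0 := by
  obtain ⟨c, hc, h⟩ := exists_tendsto_sqrt_mul_survival
  have h1 := tendsto_sqrt_mul_passageDefect (tendsto_sqrt_mul_passageTail h) t
  have h2 := (Complex.continuous_re.tendsto _).comp h1
  have h3 : 0 ≤ (-((((1 + rho ^ 2) * c : ℝ) : ℂ) * darlingMandelbrotSeries (1 / 2) t)).re := by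
    refine ge_of_tendsto' h2 fun n => ?_
    rw [Function.comp, Complex.re_ofReal_mul]
    exact mul_nonneg (Real.sqrt_nonneg _)
      (re_passageDefect_nonneg n (Complex.norm_exp_ofReal_mul_I _).le)
  rw [Complex.neg_re, Complex.re_ofReal_mul] at h3
  have h4 : 0 < (1 + rho ^ 2) * c := by positivity
  nlinarith

theorem one_le_norm_one_sub_darlingMandelbrotSeries_half (t : ℝ) :
    1 ≤ ‖1 - darlingMandelbrotSeries (1 / 2) t‖ := by
  refine le_trans ?_ (Complex.re_le_norm _)
  rw [Complex.sub_re, Complex.one_re]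
  linarith [re_darlingMandelbrotSeries_half_nonpos t]

theorem one_sub_darlingMandelbrotSeries_half_ne_zero (t : ℝ) :
    1 - darlingMandelbrotSeries (1 / 2) t ≠ 0 := by
  rw [← norm_pos_iff]
  linarith [one_le_norm_one_sub_darlingMandelbrotSeries_half t]

/-- The first term has modulus at least `1 + ρ²`, the second exactly `ρ²`. -/
theorem limit_denominator_ne_zero (t : ℝ) :
    (1 + (rho : ℂ) ^ 2) * (1 - darlingMandelbrotSeries (1 / 2) t) -
      rho ^ 2 * Complex.exp (t * Complex.I) ≠ 0 := by
  intro h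
  have h1 := congrArg norm (sub_eq_zero.1 h)
  have h2 : ‖1 + (rho : ℂ) ^ 2‖ = 1 + rho ^ 2 := by
    rw [show 1 + (rho : ℂ) ^ 2 = ((1 + rho ^ 2 : ℝ) : ℂ) by push_cast; rfl, Complex.norm_real,
      Real.norm_of_nonneg (by positivity)]
  rw [norm_mul, norm_mul, h2, Complex.norm_exp_ofReal_mul_I, norm_pow, Complex.norm_real,
    Real.norm_of_nonneg rho_pos.le, mul_one] at h1
  have := one_le_norm_one_sub_darlingMandelbrotSeries_half t
  nlinarith [sq_nonneg rho]

/-- Numerator and denominator are both of order `n ^ (-1/2)`. Scaled by `√n`, each has a limit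
proportional to `c`, which cancels. -/
theorem tendsto_drawnGenFun (t : ℝ) :
    Tendsto (fun n : ℕ => drawnGenFun n (Complex.exp ((t / n : ℝ) * Complex.I))) atTop
      (𝓝 (Complex.exp (t * Complex.I) /
        ((1 + (rho : ℂ) ^ 2) * (1 - darlingMandelbrotSeries (1 / 2) t) -
          rho ^ 2 * Complex.exp (t * Complex.I)))) := by
  obtain ⟨c, hc, h⟩ := exists_tendsto_sqrt_mul_survival
  have hc' : (c : ℂ) ≠ 0 := by exact_mod_cast hc.ne'
  set E := Complex.exp (t * Complex.I) with hE
  have hpow : ∀ᶠ n : ℕ in atTop, Complex.exp ((t / n : ℝ) * Complex.I) ^ n = E := by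
    filter_upwards [eventually_gt_atTop 0] with n hn
    have : (n : ℂ) ≠ 0 := by exact_mod_cast hn.ne'
    rw [← Complex.exp_nat_mul, hE]
    congr 1
    push_cast
    field_simp
  have hone : Tendsto (fun n : ℕ => Complex.exp ((t / n : ℝ) * Complex.I)) atTop (𝓝 1) := by
    have h1 : Tendsto (fun n : ℕ => t / (n : ℝ)) atTop (𝓝 0) :=
      tendsto_const_div_atTop_nhds_zero_nat t
    have h2 : Continuous fun x : ℝ => Complex.exp (x * Complex.I) := by fun_prop
    have h3 := (h2.tendsto 0).comp h1
    rwa [Complex.ofReal_zero, zero_mul, Complex.exp_zero] at h3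
  have hsurv : Tendsto (fun n : ℕ => (√(n : ℝ) : ℂ) * survival n 1) atTop (𝓝 c) := by
    refine ((Complex.continuous_ofReal.tendsto _).comp h).congr fun n => ?_
    simp
  have hpre : Tendsto (fun n : ℕ => (√(n : ℝ) : ℂ) * preSurvival n 1) atTop (𝓝 c) := by
    refine ((Complex.continuous_ofReal.tendsto _).comp
      (tendsto_sqrt_mul_preSurvival h)).congr fun n => ?_
    simp
  have hdef := tendsto_sqrt_mul_passageDefect (tendsto_sqrt_mul_passageTail h) t
  have hnext : Tendsto (fun n : ℕ => 1 - E * Complex.exp ((t / n : ℝ) * Complex.I)) atTop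
      (𝓝 (1 - E * 1)) := (hone.const_mul E).const_sub 1
  have hden := (hsurv.add hdef).add ((hpre.mul hnext).const_mul ((rho : ℂ) ^ 2))
  have hD : (c : ℂ) + -((((1 + rho ^ 2) * c : ℝ) : ℂ) * darlingMandelbrotSeries (1 / 2) t) +
      (rho : ℂ) ^ 2 * (c * (1 - E * 1)) =
      c * ((1 + (rho : ℂ) ^ 2) * (1 - darlingMandelbrotSeries (1 / 2) t) - rho ^ 2 * E) := by
    push_cast
    ring
  rw [hD] at hden
  have hlim := (hsurv.mul_const E).div hden (mul_ne_zero hc' (limit_denominator_ne_zero t))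
  rw [mul_div_mul_left _ _ hc'] at hlim
  refine hlim.congr' ?_
  filter_upwards [hpow, eventually_gt_atTop 0] with n hn hn0
  have hs : (√(n : ℝ) : ℂ) ≠ 0 := by
    exact_mod_cast (Real.sqrt_pos.2 (by exact_mod_cast hn0 : (0 : ℝ) < n)).ne'
  rw [drawnGenFun, one_sub_failPoly, pow_succ _ n, hn, Pi.div_apply]
  refine Eq.trans ?_ (mul_div_mul_left _ _ hs)
  congr 1
  · ring
  · ring

theorem one_add_rho_sq : 1 + rho ^ 2 = 4 - 2 * √2 := by
  rw [rho_sq, rho]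
  ring

/-- In units of `c √n`, passages, overshoot and success contribute `1 + ρ²`, `ρ²` and `1` to the
mean length of an attempt. Division by `u_n ∼ c / √n` gives `2 (1 + ρ²) n`. -/
theorem isEquivalent_drawnMean :
    (fun n => drawnMean n) ~[atTop] fun n : ℕ => (8 - 4 * √2) * (n : ℝ) := by
  obtain ⟨c, hc, h⟩ := exists_tendsto_sqrt_mul_survival
  have hK : 0 < 8 - 4 * √2 := by
    have := one_add_rho_sq
    have := sq_nonneg rho
    linarith
  have hmom := tendsto_passageMoment (tendsto_sqrt_mul_passageTail h) 0
  have hpre := (tendsto_sqrt_mul_preSurvival h).mul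
    ((tendsto_const_div_atTop_nhds_zero_nat (1 : ℝ)).const_add 1)
  have hlim := ((hmom.add (hpre.const_mul (rho ^ 2))).add h).div h hc.ne'
  have hval : ((1 + rho ^ 2) * c * (1 / 2 / (((0 : ℕ) : ℝ) + 1 - 1 / 2)) +
      rho ^ 2 * (c * (1 + 0)) + c) / c = 8 - 4 * √2 := by
    rw [show 8 - 4 * √2 = 2 * (1 + rho ^ 2) by rw [one_add_rho_sq]; ring]
    field_simp
    push_cast
    ring
  rw [hval] at hlim
  rw [isEquivalent_iff_tendsto_one]
  · have h2 := hlim.div_const (8 - 4 * √2)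
    rw [div_self hK.ne'] at h2
    refine h2.congr' ?_
    filter_upwards [eventually_gt_atTop 0] with n hn
    have hn' : (0 : ℝ) < n := by exact_mod_cast hn
    have hs : 0 < √(n : ℝ) := Real.sqrt_pos.2 hn'
    have hu := survival_pos n 0
    rw [zero_add] at hu
    simp only [Pi.div_apply, passageMoment, zero_add, pow_one, mul_div_assoc', drawnMean]
    rw [← Finset.sum_div]
    field_simp
  · filter_upwards [eventually_gt_atTop 0] with n hn
    have hn' : (0 : ℝ) < n := by exact_mod_cast hn
    positivity

end SchroderSampler

/-! ### Geometric convolutions and Lévy continuity -/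

open Topology

instance isProbabilityMeasure_convPower (ν : Measure ℝ) [IsProbabilityMeasure ν] (k : ℕ) :
    IsProbabilityMeasure (convPower ν k) := by
  induction k with
  | zero => exact inferInstanceAs (IsProbabilityMeasure (Measure.dirac (0 : ℝ)))
  | succ k ih => exact inferInstanceAs (IsProbabilityMeasure (Measure.conv (convPower ν k) ν))

theorem charFun_convPower (ν : Measure ℝ) [IsProbabilityMeasure ν] (k : ℕ) (t : ℝ) :
    charFun (convPower ν k) t = charFun ν t ^ k := by
  induction k with
  | zero => simp [convPower, charFun_dirac]
  | succ k ih => rw [convPower, charFun_conv, ih, pow_succ]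

section GeometricConvolution

variable {p : ℝ} (ν : Measure ℝ) [IsProbabilityMeasure ν]

theorem isProbabilityMeasure_geometricConvolution (hp : 0 < p) (hp1 : p ≤ 1) :
    IsProbabilityMeasure (geometricConvolution p ν) := by
  constructor
  have h0 : 0 ≤ 1 - p := sub_nonneg.2 hp1
  have hg : HasSum (fun k : ℕ => (1 - p) ^ k * p) 1 := by
    have := (hasSum_geometric_of_lt_one h0 (by linarith)).mul_right p
    rwa [sub_sub_cancel, inv_mul_cancel₀ hp.ne'] at this
  rw [geometricConvolution, Measure.sum_apply _ MeasurableSet.univ]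
  simp only [Measure.smul_apply, measure_univ, smul_eq_mul, mul_one]
  rw [← ENNReal.ofReal_tsum_of_nonneg (fun k => by positivity) hg.summable, hg.tsum_eq,
    ENNReal.ofReal_one]

theorem charFun_geometricConvolution (hp : 0 < p) (hp1 : p ≤ 1) (t : ℝ) :
    charFun (geometricConvolution p ν) t =
      p * charFun ν t / (1 - (1 - p) * charFun ν t) := by
  have h0 : 0 ≤ 1 - p := sub_nonneg.2 hp1
  have := isProbabilityMeasure_geometricConvolution ν hp hp1
  have hint : Integrable (fun x : ℝ => Complex.exp (t * x * Complex.I))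
      (geometricConvolution p ν) := by
    refine Integrable.of_bound (by fun_prop) 1 (ae_of_all _ fun x => ?_)
    rw [← Complex.ofReal_mul, Complex.norm_exp_ofReal_mul_I]
  have h1 := hasSum_integral_measure hint
  rw [← geometricConvolution, ← charFun_apply_real] at h1
  have hr : ‖((1 - p : ℝ) : ℂ) * charFun ν t‖ < 1 := by
    rw [norm_mul, Complex.norm_real, Real.norm_of_nonneg h0]
    have := norm_charFun_le_one (μ := ν) t
    nlinarith [norm_nonneg (charFun ν t)]
  have h2 := (hasSum_geometric_of_norm_lt_one hr).mul_left (p * charFun ν t)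
  push_cast at h2
  rw [← div_eq_mul_inv] at h2
  refine h1.unique (h2.congr_fun fun k => ?_)
  rw [integral_smul_measure, ← charFun_apply_real, charFun_convPower,
    ENNReal.toReal_ofReal (by positivity), Complex.real_smul, mul_pow]
  push_cast
  ring

end GeometricConvolution

/-- A pointwise limit of characteristic functions that is continuous at `0` is a characteristic
function. -/
theorem exists_probabilityMeasure_of_tendsto_charFun {ν : ℕ → Measure ℝ}
    [∀ n, IsProbabilityMeasure (ν n)] {f : ℝ → ℂ} (hf : ContinuousAt f 0)
    (h : ∀ t, Tendsto (fun n => charFun (ν n) t) atTop (𝓝 (f t))) :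
    ∃ L : ProbabilityMeasure ℝ, ∀ t, charFun (L : Measure ℝ) t = f t := by
  have htight := isTightMeasureSet_of_tendsto_charFun hf h
  set P : ℕ → ProbabilityMeasure ℝ := fun n => ⟨ν n, inferInstance⟩
  have hcompact : IsCompact (closure (Set.range P)) := by
    refine isCompact_closure_of_isTightMeasureSet ?_
    have hset : {m | ∃ x ∈ Set.range P, (x : Measure ℝ) = m} = Set.range ν := by
      ext m
      constructor
      · rintro ⟨_, ⟨n, rfl⟩, rfl⟩
        exact ⟨n, rfl⟩
      · rintro ⟨n, rfl⟩
        exact ⟨P n, ⟨n, rfl⟩, rfl⟩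
    rwa [hset]
  -- A limit along an ultrafilter finer than `atTop` replaces the extraction of a subsequence.
  let U : Ultrafilter ℕ := Ultrafilter.of atTop
  have hU : (U : Filter ℕ) ≤ atTop := Ultrafilter.of_le atTop
  obtain ⟨L, -, hL⟩ := hcompact.ultrafilter_le_nhds (U.map P)
    (le_principal_iff.2 (mem_map.2 (univ_mem' fun n => subset_closure ⟨n, rfl⟩)))
  refine ⟨L, fun t => ?_⟩
  have hL' : Tendsto P U (𝓝 L) := hL
  rw [ProbabilityMeasure.tendsto_iff_forall_integral_rclike_tendsto ℂ] at hL'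
  have h1 := hL' (BoundedContinuousFunction.innerProbChar t)
  simp_rw [← charFun_eq_integral_innerProbChar] at h1
  exact tendsto_nhds_unique h1 ((h t).mono_left hU)

/-! ### Existence of the limit laws -/

namespace SchroderSampler

open SchroderStep

/-- The law of the length at passage divided by `n`, replaced by `0` if it exceeds `1`. -/
noncomputable def truncatedPassageLaw (n : ℕ) : Measure ℝ :=
  ∑ m ∈ Finset.range (n + 1), ENNReal.ofReal (passage m 1) • Measure.dirac ((m : ℝ) / n) +
    ENNReal.ofReal (passageTail n) • Measure.dirac 0

instance (n : ℕ) : IsProbabilityMeasure (truncatedPassageLaw n) := by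
  constructor
  have h := sum_passage_add_passageTail n
  simp only [truncatedPassageLaw, Measure.add_apply, Measure.finsetSum_apply, Measure.smul_apply,
    measure_univ, smul_eq_mul, mul_one]
  rw [← ENNReal.ofReal_sum_of_nonneg fun m _ => passage_nonneg m 1,
    ← ENNReal.ofReal_add (Finset.sum_nonneg fun m _ => passage_nonneg m 1) (passageTail_pos n).le,
    h, ENNReal.ofReal_one]

theorem charFun_truncatedPassageLaw (n : ℕ) (t : ℝ) : charFun (truncatedPassageLaw n) t =
    1 - passageDefect n (Complex.exp ((t / n : ℝ) * Complex.I)) := by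
  have hint : ∀ (c x : ℝ), Integrable (fun x : ℝ => Complex.exp (t * x * Complex.I))
      (ENNReal.ofReal c • Measure.dirac x) := fun c x => by
    refine Integrable.smul_measure ?_ ENNReal.ofReal_ne_top
    refine Integrable.of_bound (by fun_prop) 1 (ae_of_all _ fun x => ?_)
    rw [← Complex.ofReal_mul, Complex.norm_exp_ofReal_mul_I]
  have h := congrArg Complex.ofReal (sum_passage_add_passageTail n)
  push_cast at h
  rw [charFun_apply_real, truncatedPassageLaw, integral_add_measure
    (integrable_finsetSum_measure.2 fun m _ => hint _ _) (hint _ _),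
    integral_finsetSum_measure fun m _ => hint _ _]
  simp only [integral_smul_measure, integral_dirac, Complex.real_smul,
    ENNReal.toReal_ofReal (passage_nonneg _ _), ENNReal.toReal_ofReal (passageTail_pos n).le,
    passageDefect, mul_sub, mul_one, Finset.sum_sub_distrib, ← Complex.exp_nat_mul]
  rw [← h]
  simp only [Complex.ofReal_zero, mul_zero, zero_mul, Complex.exp_zero, mul_one]
  have : ∀ m : ℕ, (t : ℂ) * ((m / n : ℝ) : ℂ) * Complex.I = m * ((t / n : ℝ) * Complex.I) := by
    intro m
    push_cast
    ring
  simp_rw [this]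
  ring

/-- The Darling–Mandelbrot law of parameter `1/2` exists. -/
theorem exists_charFun_eq_darlingMandelbrotCharFun_half :
    ∃ L : ProbabilityMeasure ℝ, ∀ t, charFun (L : Measure ℝ) t =
      darlingMandelbrotCharFun (1 / 2) t := by
  -- With `q` the passage tail and `d` the defect, this compound has characteristic function `q (1 -
  -- d) / (d + q (1 - d))`. Here `√n q → K`, `√n d → -K D` and `d → 0`, so the limit is `1 / (1 -
  -- D)`.
  have hprob : ∀ n, IsProbabilityMeasure
      (geometricConvolution (passageTail n) (truncatedPassageLaw n)) := fun n =>
    isProbabilityMeasure_geometricConvolution _ (passageTail_pos n) (passageTail_le_one n)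
  refine exists_probabilityMeasure_of_tendsto_charFun
    (ν := fun n => geometricConvolution (passageTail n) (truncatedPassageLaw n)) ?_ fun t => ?_
  · simp_rw [funext (darlingMandelbrotCharFun_eq _)]
    exact (continuousAt_const.sub continuousAt_darlingMandelbrotSeries_half).inv₀
      (one_sub_darlingMandelbrotSeries_half_ne_zero 0)
  · obtain ⟨c, hc, h⟩ := exists_tendsto_sqrt_mul_survival
    replace h := tendsto_sqrt_mul_passageTail h
    set K : ℝ := (1 + rho ^ 2) * c with hK
    have hK0 : (K : ℂ) ≠ 0 := by
      have : 0 < K := by positivity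
      exact_mod_cast this.ne'
    have hdef := tendsto_sqrt_mul_passageDefect h t
    have hinv : Tendsto (fun n : ℕ => (((√(n : ℝ))⁻¹ : ℝ) : ℂ)) atTop (𝓝 0) := by
      have h1 : Tendsto (fun n : ℕ => (√(n : ℝ))⁻¹) atTop (𝓝 0) :=
        tendsto_inv_atTop_zero.comp (Real.tendsto_sqrt_atTop.comp tendsto_natCast_atTop_atTop)
      have h2 := (Complex.continuous_ofReal.tendsto _).comp h1
      rwa [Complex.ofReal_zero] at h2
    have hs : ∀ᶠ n : ℕ in atTop, (√(n : ℝ) : ℂ) ≠ 0 := by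
      filter_upwards [eventually_gt_atTop 0] with n hn
      exact_mod_cast (Real.sqrt_pos.2 (by exact_mod_cast hn : (0 : ℝ) < n)).ne'
    have hdef0 : Tendsto (fun n : ℕ => passageDefect n
        (Complex.exp ((t / n : ℝ) * Complex.I))) atTop (𝓝 0) := by
      have h1 := hinv.mul hdef
      rw [zero_mul] at h1
      refine h1.congr' ?_
      filter_upwards [hs] with n hn
      rw [Complex.ofReal_inv, inv_mul_cancel_left₀ hn]
    have htail : Tendsto (fun n : ℕ => (√(n : ℝ) : ℂ) * passageTail n) atTop (𝓝 K) := by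
      refine ((Complex.continuous_ofReal.tendsto _).comp h).congr fun n => ?_
      simp
    have hnum := htail.mul (hdef0.const_sub 1)
    have hlim := hnum.div (hdef.add hnum) (by
      rw [sub_zero, mul_one, show -((K : ℂ) * darlingMandelbrotSeries (1 / 2) t) + K =
        K * (1 - darlingMandelbrotSeries (1 / 2) t) by ring]
      exact mul_ne_zero hK0 (one_sub_darlingMandelbrotSeries_half_ne_zero t))
    rw [sub_zero, mul_one, show -((K : ℂ) * darlingMandelbrotSeries (1 / 2) t) + K =
        K * (1 - darlingMandelbrotSeries (1 / 2) t) by ring, ← div_div, div_self hK0, one_div,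
      ← darlingMandelbrotCharFun_eq] at hlim
    refine hlim.congr' ?_
    filter_upwards [hs] with n hn
    rw [charFun_geometricConvolution _ (passageTail_pos n) (passageTail_le_one n),
      charFun_truncatedPassageLaw, Pi.div_apply]
    refine Eq.trans ?_ (mul_div_mul_left _ _ hn)
    congr 1
    · ring
    · ring

theorem exists_isShiftedDarlingMandelbrot_half :
    ∃ ν : Measure ℝ, IsShiftedDarlingMandelbrot (1 / 2) ν := by
  obtain ⟨L, hL⟩ := exists_charFun_eq_darlingMandelbrotCharFun_half
  refine ⟨(Measure.dirac 1).conv L, inferInstance, fun s => ?_⟩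
  rw [charFun_conv, hL, charFun_dirac]
  congr 2
  simp [mul_comm]

theorem exists_geometricDarlingMandelbrot :
    ∃ L : ProbabilityMeasure ℝ,
      IsGeometricDarlingMandelbrot (1 / 2) ((2 + √2) / 4) (L : Measure ℝ) ∧
      ∀ t, charFun (L : Measure ℝ) t = Complex.exp (t * Complex.I) /
        ((1 + (rho : ℂ) ^ 2) * (1 - darlingMandelbrotSeries (1 / 2) t) -
          rho ^ 2 * Complex.exp (t * Complex.I)) := by
  obtain ⟨ν, hν⟩ := exists_isShiftedDarlingMandelbrot_half
  have := hν.isProbabilityMeasure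
  set p : ℝ := (2 + √2) / 4 with hp
  -- The parameter is exactly the inverse of `1 + ρ²`, which matches the compound's characteristic
  -- function with the limit found for the sampler.
  have hpr : p * (1 + rho ^ 2) = 1 := by
    have : √2 ^ 2 = 2 := Real.sq_sqrt (by norm_num)
    rw [one_add_rho_sq, hp]
    linear_combination -this / 2
  have hp0 : 0 < p := by positivity
  have hp1 : p ≤ 1 := by nlinarith [sq_nonneg rho]
  refine ⟨⟨geometricConvolution p ν, isProbabilityMeasure_geometricConvolution ν hp0 hp1⟩,
    ⟨ν, hν, rfl⟩, fun t => ?_⟩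
  change charFun (geometricConvolution p ν) t = _
  rw [charFun_geometricConvolution ν hp0 hp1, hν.charFun_eq, darlingMandelbrotCharFun_eq,
    mul_comm Complex.I]
  have hpr' : (p : ℂ) * (1 + (rho : ℂ) ^ 2) = 1 := by exact_mod_cast congrArg Complex.ofReal hpr
  have h1 := one_sub_darlingMandelbrotSeries_half_ne_zero t
  have h2 := limit_denominator_ne_zero t
  have hr : 1 + (rho : ℂ) ^ 2 ≠ 0 := right_ne_zero_of_mul_eq_one hpr'
  rw [eq_div_of_mul_eq hr hpr']
  generalize Complex.exp (t * Complex.I) = E at *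
  generalize 1 - darlingMandelbrotSeries (1 / 2) t = D at *
  have h3 : 1 - (1 - 1 / (1 + (rho : ℂ) ^ 2)) * (E * D⁻¹) =
      ((1 + (rho : ℂ) ^ 2) * D - rho ^ 2 * E) / ((1 + (rho : ℂ) ^ 2) * D) := by
    field_simp
    ring
  rw [h3, div_div_eq_mul_div]
  congr 1
  field_simp

end SchroderSampler

/-! ### The proposition -/

theorem proposition2 {Ω : Type*} [MeasurableSpace Ω] (μ : Measure Ω) [IsProbabilityMeasure μ]
    (S : ℕ → Ω → SchroderStep) (hS : ∀ i, Measurable (S i)) (hindep : iIndepFun S μ)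
    (hlaw : ∀ i s, μ.real (S i ⁻¹' {s}) = s.weight) :
    (∀ n : ℕ, ∀ᵐ ω ∂μ, SchroderSampler.Halts n (fun i => S i ω)) ∧
    (∃ L : ProbabilityMeasure ℝ,
      IsGeometricDarlingMandelbrot (1 / 2) ((2 + √2) / 4) (L : Measure ℝ) ∧
      TendstoInDistribution
        (fun (n : ℕ) (ω : Ω) =>
          (SchroderSampler.drawnLength n (fun i => S i ω) : ℝ) / (n : ℝ))
        atTop (id : ℝ → ℝ) (fun _ => μ) (L : Measure ℝ)) ∧
    (∀ n : ℕ, Integrable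
      (fun ω => (SchroderSampler.drawnLength n (fun i => S i ω) : ℝ)) μ) ∧
    (fun n : ℕ => ∫ ω, (SchroderSampler.drawnLength n (fun i => S i ω) : ℝ) ∂μ)
      ~[atTop] (fun n : ℕ => (8 - 4 * √2) * (n : ℝ)) := by
  refine ⟨SchroderSampler.ae_halts hS hindep hlaw, ?_,
    SchroderSampler.integrable_drawnLength hS hindep hlaw, ?_⟩
  · obtain ⟨L, hL, hchar⟩ := SchroderSampler.exists_geometricDarlingMandelbrot
    have hm : ∀ n : ℕ, AEMeasurable (fun ω =>
        (SchroderSampler.drawnLength n (fun i => S i ω) : ℝ) / (n : ℝ)) μ := fun n =>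
      (SchroderSampler.aestronglyMeasurable_drawnLength hS hindep hlaw n).aemeasurable.div_const _
    refine ⟨L, hL, hm, aemeasurable_id, ?_⟩
    refine ProbabilityMeasure.tendsto_iff_tendsto_charFun.2 fun t => ?_
    change Tendsto (fun n : ℕ => charFun (μ.map fun ω =>
      (SchroderSampler.drawnLength n (fun i => S i ω) : ℝ) / n) t) atTop
      (𝓝 (charFun ((L : Measure ℝ).map id) t))
    simp_rw [Measure.map_id, hchar, SchroderSampler.charFun_map_drawnLength_div hS hindep hlaw]
    exact SchroderSampler.tendsto_drawnGenFun t
  · simp_rw [SchroderSampler.integral_drawnLength hS hindep hlaw]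
    exact SchroderSampler.isEquivalent_drawnMean
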